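/- Let $K\subseteq U(N)$ be a compact Lie group (a closed subgroup of a unitary group) with semisimple Lie algebra $\mathfrak k$, i.e. with non-degenerate Killing form $\kappa$. (This covers compact, connected, simply connected groups and compact, connected, centerfree groups.) Let $\langle\cdot,\cdot\rangle=-\kappa$ be the Killing inner product on $\mathfrak k$, extended to a Hermitian inner product (linear in the second argument) on $\mathfrak k_{\mathbb C}$. Let $\mathcal H=L^2(S^1,\mathfrak k_{\mathbb C})$ with measure $d\theta/2\pi$ and $z=e^{i\theta}$. Let $\mathcal H_+$ be the closed span of the $\epsilon z^k$ with $k\ge 0$, $\epsilon\in\mathfrak k_{\mathbb C}$, and $\mathcal H_-=\mathcal H_+^{\perp}$. Let $Gr(\mathcal H)$ be the set of closed subspaces $W$ such that $\mathrm{pr}_+:W\to\mathcal H_+$ is Fredholm and $\mathrm{pr}_-:W\to\mathcal H_-$ is Hilbert–Schmidt. Charts are given by graphs over $W$, so that $T_W Gr(\mathcal H)=HS(W,W^\perp)$, and the Hilbert–Schmidt form is $$\omega_{HS}(S,T)=-i\,\mathrm{tr}(S^*T-T^*S),\qquad S,T\in HS(W,W^\perp).$$ Let $Gr_0(\mathcal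 H)=\bigcup_m\{W\in Gr(\mathcal H): z^m\mathcal H_+\subseteq W\subseteq z^{-m}\mathcal H_+\}$. Let $\Omega_{\mathrm{alg}}K$ be the group of loops $\gamma:S^1\to K$ with $\gamma(1)=e$ whose matrix entries are Laurent polynomials in $z$. Its tangent vectors at $\gamma$ are the $\gamma X$, where $X$ is a $\mathfrak k$-valued Laurent polynomial loop with $X(1)=0$. It carries the left-invariant form $$\omega_{\Omega K}(\gamma X,\gamma Y)=\omega_{\Omega K}(X,Y)=\frac1{2\pi}\int_0^{2\pi}\langle X(\theta),Y'(\theta)\rangle\,d\theta .$$ Let $\phi(\gamma)=\gamma\cdot\mathcal H_+=\{\mathrm{Ad}_\gamma f: f\in\mathcal H_+\}$. Then $\phi$ is a well-defined injective map $\Omega_{\mathrm{alg}}K\to Gr_0(\mathcal H)$. At each $\gamma\in\Omega_{\mathrm{alg}}K$, with $W=\phi(\gamma)$, it has an injective real-linear differential $d\phi_\gamma$ with values in $HS(W,W^\perp)$: for every curve in $\Omega_{\mathrm{alg}}K$ through $\gamma$, of bounded degree near time $0$ and differentiable at $0$ with velocity $\gamma X$, the image curve, read in the chart at $W$, is differentiable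 at $0$ in Hilbert–Schmidt norm with derivative $d\phi_\gamma(\gamma X)$. Moreover $d\phi_\gamma(\gamma X)\,w=\mathrm{pr}_{W^\perp}[\mathrm{Ad}_\gamma X,w]$ for $w\in W$. The form $\omega_{HS}$ pulls back to $\omega_{\Omega K}$, that is, for all $\gamma$, $X$, $Y$, $$\omega_{HS}\big(d\phi_\gamma(\gamma X),d\phi_\gamma(\gamma Y)\big)=\omega_{\Omega K}(X,Y)=i\sum_{k\in\mathbb Z}k\,\mathrm{tr}(A_k^*B_k),$$ where $X=\sum_k A_ke^{ik\theta}$, $Y=\sum_k B_ke^{ik\theta}$ with $A_k,B_k\in\mathfrak k_{\mathbb C}$, and $\mathrm{tr}(A^*B)$ means $\mathrm{tr}(\mathrm{ad}(A)^*\,\mathrm{ad}(B))$ on $\mathfrak k_{\mathbb C}$. -/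

import Mathlib

open MeasureTheory Filter Topology
open scoped ENNReal Real InnerProductSpace Matrix ComplexOrder

noncomputable section

namespace LoopGr

/-! ## Compact Lie groups, their Lie algebras and the Killing form

A compact Lie group is given as a closed subgroup `K` of a unitary group `U(N)`. -/

section LieAlgebra

variable {N : ℕ}

/-- `N × N` complex matrices. -/
abbrev Mat (N : ℕ) : Type := Matrix (Fin N) (Fin N) ℂ

/-- The commutator bracket on matrices. -/
instance (N : ℕ) : LieRing (Mat N) := LieRing.ofAssociativeRing

/-- The unitary group `U(N)`. -/
abbrev UN (N : ℕ) : Type := Matrix.unitaryGroup (Fin N) ℂ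

theorem hasDerivAt_mat {f : ℝ → Mat N} {f' : Mat N} {x : ℝ} :
    HasDerivAt f f' x ↔ ∀ i j, HasDerivAt (fun t => f t i j) (f' i j) x := by
  let _ : NormedAddCommGroup (Mat N) := Matrix.normedAddCommGroup
  let _ : NormedSpace ℝ (Mat N) := Matrix.normedSpace
  constructor
  · intro h i j
    exact hasDerivAt_pi.1 (hasDerivAt_pi.1 h i) j
  · intro h
    exact hasDerivAt_pi.2 fun i => hasDerivAt_pi.2 fun j => h i j

theorem hasDerivAt_mul {f g : ℝ → Mat N} {f' g' : Mat N} {x : ℝ}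
    (hf : HasDerivAt f f' x) (hg : HasDerivAt g g' x) :
    HasDerivAt (fun t => f t * g t) (f' * g x + f x * g') x := by
  rw [hasDerivAt_mat] at *
  intro i j
  simp only [Matrix.mul_apply, Matrix.add_apply, ← Finset.sum_add_distrib]
  exact HasDerivAt.fun_sum fun k _ => (hf i k).mul (hg k j)

theorem hasDerivAt_star {f : ℝ → Mat N} {f' : Mat N} {x : ℝ}
    (hf : HasDerivAt f f' x) : HasDerivAt (fun t => star (f t)) (star f') x := by
  rw [hasDerivAt_mat] at *
  intro i j
  exact (hf j i).star

/-- The velocities at the identity of curves in `K`, as a real subspace. -/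
def tangentOne (K : Subgroup (UN N)) : Submodule ℝ (Mat N) where
  carrier := {X | ∃ c : ℝ → UN N, (∀ t, c t ∈ K) ∧ c 0 = 1 ∧
    HasDerivAt (fun t => (c t : Mat N)) X 0}
  zero_mem' := ⟨fun _ => 1, fun _ => K.one_mem, rfl, by
    rw [hasDerivAt_mat]; intro i j; exact hasDerivAt_const _ _⟩
  add_mem' := by
    rintro X Y ⟨c, hc, hc0, hcX⟩ ⟨d, hd, hd0, hdY⟩
    refine ⟨fun t => c t * d t, fun t => K.mul_mem (hc t) (hd t), by simp [hc0, hd0], ?_⟩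
    have := hasDerivAt_mul hcX hdY
    simpa [hc0, hd0] using this
  smul_mem' := by
    rintro r X ⟨c, hc, hc0, hcX⟩
    refine ⟨fun t => c (r * t), fun t => hc _, by simp [hc0], ?_⟩
    rw [hasDerivAt_mat] at *
    intro i j
    have h1 : HasDerivAt (fun t : ℝ => r * t) r 0 := by
      simpa using (hasDerivAt_id (0 : ℝ)).const_mul r
    have h2 : HasDerivAt (fun t => (c t : Mat N) i j) (X i j) (r * 0) := by
      simpa using hcX i j
    have h3 := h2.scomp (0 : ℝ) h1
    simpa [Function.comp_def] using h3

theorem conj_mem_tangentOne (K : Subgroup (UN N)) {k : UN N} (hk : k ∈ K) {X : Mat N}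
    (hX : X ∈ tangentOne K) : (k : Mat N) * X * star (k : Mat N) ∈ tangentOne K := by
  obtain ⟨c, hc, hc0, hcX⟩ := hX
  refine ⟨fun t => k * c t * k⁻¹,
    fun t => K.mul_mem (K.mul_mem hk (hc t)) (K.inv_mem hk), by simp [hc0], ?_⟩
  have h1 : HasDerivAt (fun _ : ℝ => (k : Mat N)) 0 0 := by
    rw [hasDerivAt_mat]; intro i j; exact hasDerivAt_const _ _
  have h2 : HasDerivAt (fun _ : ℝ => star (k : Mat N)) 0 0 := by
    rw [hasDerivAt_mat]; intro i j; exact hasDerivAt_const _ _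
  simpa using hasDerivAt_mul (hasDerivAt_mul h1 hcX) h2

theorem star_of_mem_tangentOne (K : Subgroup (UN N)) {X : Mat N}
    (hX : X ∈ tangentOne K) : star X = -X := by
  obtain ⟨c, hc, hc0, hcX⟩ := hX
  have h := hasDerivAt_mul (hasDerivAt_star hcX) hcX
  have h1 : (fun t => star (c t : Mat N) * (c t : Mat N)) = fun _ => 1 := by
    funext t; exact Unitary.coe_star_mul_self (c t)
  rw [h1] at h
  have h2 : HasDerivAt (fun _ : ℝ => (1 : Mat N)) 0 0 := by
    rw [hasDerivAt_mat]; intro i j; exact hasDerivAt_const _ _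
  rw [hasDerivAt_mat] at h h2
  have h3 : star X + X = 0 := by
    ext i j
    have := (h i j).unique (h2 i j)
    simpa [hc0] using this
  exact eq_neg_of_add_eq_zero_left h3

/-- The Lie algebra `𝔨` of `K`: velocities at the identity of curves in `K`, with the commutator
bracket. -/
def lieAlg (K : Subgroup (UN N)) : LieSubalgebra ℝ (Mat N) :=
  { tangentOne K with
    lie_mem' := by
      intro X Y hX hY
      have hX' := hX
      obtain ⟨c, hc, hc0, hcX⟩ := hX
      let _ : NormedAddCommGroup (Mat N) := Matrix.normedAddCommGroup
      let _ : NormedSpace ℝ (Mat N) := Matrix.normedSpace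
      have hconst : HasDerivAt (fun _ : ℝ => Y) 0 0 := by
        rw [hasDerivAt_mat]; intro i j; exact hasDerivAt_const _ _
      have h := hasDerivAt_mul (hasDerivAt_mul hcX hconst) (hasDerivAt_star hcX)
      have hcl : IsClosed (tangentOne K : Set (Mat N)) :=
        Submodule.closed_of_finiteDimensional _
      have hsl := h.tendsto_slope
      have hmem : (X * Y + Y * star X) ∈ tangentOne K := by
        have h' : Tendsto (slope (fun t => (c t : Mat N) * Y * star (c t : Mat N)) 0) (𝓝[≠] 0)
            (𝓝 (X * Y + Y * star X)) := by
          have h0 : X * Y + Y * star X = (X * Y + (c 0 : Mat N) * 0) * star (c 0 : Mat N) +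
              (c 0 : Mat N) * Y * star X := by simp [hc0]
          rw [h0]
          exact hsl
        refine hcl.mem_of_tendsto h' (Eventually.of_forall fun t => ?_)
        rw [slope_def_module]
        refine (tangentOne K).smul_mem _ ((tangentOne K).sub_mem ?_ ?_)
        · exact conj_mem_tangentOne K (hc t) hY
        · exact conj_mem_tangentOne K (hc 0) hY
      rw [star_of_mem_tangentOne K hX'] at hmem
      change ⁅X, Y⁆ ∈ tangentOne K
      rw [Ring.lie_def, sub_eq_add_neg, ← mul_neg]
      exact hmem }

theorem star_of_mem_lieAlg (K : Subgroup (UN N)) {X : Mat N} (hX : X ∈ lieAlg K) :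
    star X = -X := star_of_mem_tangentOne K hX

/-- The complexification `𝔨_ℂ = 𝔨 ⊕ i𝔨`; the sum is direct because `𝔨` consists of skew-Hermitian
matrices. -/
def lieAlgC (K : Subgroup (UN N)) : LieSubalgebra ℂ (Mat N) where
  carrier := {A | ∃ X ∈ lieAlg K, ∃ Y ∈ lieAlg K, A = X + Complex.I • Y}
  zero_mem' := ⟨0, (lieAlg K).zero_mem, 0, (lieAlg K).zero_mem, by simp⟩
  add_mem' := by
    rintro A B ⟨X, hX, Y, hY, rfl⟩ ⟨X', hX', Y', hY', rfl⟩
    exact ⟨X + X', (lieAlg K).add_mem hX hX', Y + Y', (lieAlg K).add_mem hY hY', by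
      rw [smul_add]; abel⟩
  smul_mem' := by
    rintro z A ⟨X, hX, Y, hY, rfl⟩
    refine ⟨z.re • X - z.im • Y, (lieAlg K).sub_mem ((lieAlg K).smul_mem _ hX)
      ((lieAlg K).smul_mem _ hY), z.re • Y + z.im • X, (lieAlg K).add_mem
      ((lieAlg K).smul_mem _ hY) ((lieAlg K).smul_mem _ hX), ?_⟩
    ext i j
    simp only [Matrix.smul_apply, Matrix.add_apply, Matrix.sub_apply, smul_eq_mul,
      Complex.real_smul]
    conv_lhs => rw [← Complex.re_add_im z]
    linear_combination (z.im * Y i j) * Complex.I_sq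
  lie_mem' := by
    rintro A B ⟨X, hX, Y, hY, rfl⟩ ⟨X', hX', Y', hY', rfl⟩
    refine ⟨⁅X, X'⁆ - ⁅Y, Y'⁆, (lieAlg K).sub_mem ((lieAlg K).lie_mem hX hX')
      ((lieAlg K).lie_mem hY hY'), ⁅X, Y'⁆ + ⁅Y, X'⁆, (lieAlg K).add_mem
      ((lieAlg K).lie_mem hX hY') ((lieAlg K).lie_mem hY hX'), ?_⟩
    rw [add_lie, lie_add, lie_add, smul_lie, smul_lie, lie_smul, lie_smul, smul_smul,
      Complex.I_mul_I, neg_one_smul, smul_add]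
    abel

theorem star_mem_lieAlgC (K : Subgroup (UN N)) {A : Mat N} (hA : A ∈ lieAlgC K) :
    star A ∈ lieAlgC K := by
  obtain ⟨X, hX, Y, hY, rfl⟩ := hA
  refine ⟨-X, (lieAlg K).neg_mem hX, Y, hY, ?_⟩
  rw [star_add, star_smul, star_of_mem_lieAlg K hX, star_of_mem_lieAlg K hY]
  simp

/-- The complexified Lie algebra `𝔨_ℂ` as a type; it carries the norm of the Killing form. -/
def KC (K : Subgroup (UN N)) : Type := ↥(lieAlgC K)

instance (K : Subgroup (UN N)) : LieRing (KC K) := inferInstanceAs (LieRing ↥(lieAlgC K))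
instance (K : Subgroup (UN N)) : LieAlgebra ℂ (KC K) :=
  inferInstanceAs (LieAlgebra ℂ ↥(lieAlgC K))
instance (K : Subgroup (UN N)) : FiniteDimensional ℂ (KC K) :=
  inferInstanceAs (FiniteDimensional ℂ (lieAlgC K).toSubmodule)

/-- The inclusion of `𝔨_ℂ` in the matrices. -/
def KC.val {K : Subgroup (UN N)} (A : KC K) : Mat N := Subtype.val (p := (· ∈ lieAlgC K)) A

/-- The inclusion of `𝔨` in `𝔨_ℂ`. -/
def KC.ofReal {K : Subgroup (UN N)} (X : lieAlg K) : KC K :=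
  (⟨X, X, X.2, 0, (lieAlg K).zero_mem, by simp⟩ : ↥(lieAlgC K))

/-- `A ↦ A*` on `𝔨_ℂ`; the complex conjugation of `𝔨_ℂ` with respect to `𝔨` is `A ↦ -A*`. -/
def KC.conjT {K : Subgroup (UN N)} (A : KC K) : KC K :=
  (⟨star A.val, star_mem_lieAlgC K A.2⟩ : ↥(lieAlgC K))

theorem KC.val_injective {K : Subgroup (UN N)} : Function.Injective (KC.val (K := K)) :=
  Subtype.val_injective

theorem KC.val_conjT {K : Subgroup (UN N)} (A : KC K) : A.conjT.val = star A.val := rfl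

theorem KC.val_lie {K : Subgroup (UN N)} (A B : KC K) :
    (⁅A, B⁆ : KC K).val = A.val * B.val - B.val * A.val := rfl

theorem KC.val_add {K : Subgroup (UN N)} (A B : KC K) : (A + B).val = A.val + B.val := rfl

theorem KC.val_smul {K : Subgroup (UN N)} (z : ℂ) (A : KC K) : (z • A).val = z • A.val := rfl

theorem KC.conjT_add {K : Subgroup (UN N)} (A B : KC K) :
    (A + B).conjT = A.conjT + B.conjT :=
  KC.val_injective (by simp only [KC.val_conjT, KC.val_add, star_add])

theorem KC.conjT_smul {K : Subgroup (UN N)} (z : ℂ) (A : KC K) :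
    (z • A).conjT = (starRingEnd ℂ z) • A.conjT :=
  KC.val_injective (by simp only [KC.val_conjT, KC.val_smul, star_smul]; rfl)

/-- In a basis orthonormal for `tr (A* B)`, the Hermitian form `κ(A*, B)` is a sum of squares. -/
theorem exists_killing_sum (K : Subgroup (UN N)) :
    ∃ (n : ℕ) (b : Module.Basis (Fin n) ℂ (KC K)), ∀ A B : KC K,
      killingForm ℂ (KC K) A.conjT B =
        ∑ i, Matrix.trace (star (⁅A, b i⁆ : KC K).val * (⁅B, b i⁆ : KC K).val) := by
  let core : InnerProductSpace.Core ℂ (KC K) :=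
    { inner := fun A B => Matrix.trace (star A.val * B.val)
      conj_inner_symm := fun A B => by
        change star (Matrix.trace (Matrix.conjTranspose B.val * A.val)) = _
        rw [← Matrix.trace_conjTranspose, Matrix.conjTranspose_mul,
          Matrix.conjTranspose_conjTranspose]
        rfl
      re_inner_nonneg := fun A => by
        have := (Matrix.posSemidef_conjTranspose_mul_self A.val).trace_nonneg
        exact (Complex.le_def.1 this).1
      add_left := fun A B C => by
        rw [KC.val_add, star_add, add_mul, Matrix.trace_add]
      smul_left := fun A B z => by
        rw [KC.val_smul, star_smul, smul_mul_assoc, Matrix.trace_smul]; rfl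
      definite := fun A h => by
        apply KC.val_injective
        exact Matrix.trace_conjTranspose_mul_self_eq_zero_iff.1 h }
  let _ : NormedAddCommGroup (KC K) := core.toNormedAddCommGroup
  let _ : InnerProductSpace ℂ (KC K) := InnerProductSpace.ofCore core.toCore
  let b := stdOrthonormalBasis ℂ (KC K)
  refine ⟨_, b.toBasis, fun A B => ?_⟩
  rw [killingForm_apply_apply, LinearMap.trace_eq_sum_inner _ b]
  refine Finset.sum_congr rfl fun i _ => ?_
  change Matrix.trace (star (b i).val * (⁅A.conjT, ⁅B, b i⁆⁆ : KC K).val) = _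
  rw [OrthonormalBasis.coe_toBasis, KC.val_lie, KC.val_conjT, KC.val_lie A]
  generalize (⁅B, b i⁆ : KC K).val = C
  rw [star_sub, star_mul, star_mul, mul_sub, sub_mul, Matrix.trace_sub, Matrix.trace_sub,
    Matrix.mul_assoc, ← Matrix.mul_assoc _ C, Matrix.trace_mul_comm (star (b i).val * C),
    ← Matrix.mul_assoc (star A.val)]

theorem KC.eq_zero_of_lie {K : Subgroup (UN N)} [LieAlgebra.IsKilling ℝ (lieAlg K)] {A : KC K}
    (h : ∀ B : KC K, ⁅A, B⁆ = 0) : A = 0 := by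
  obtain ⟨X, hX, Y, hY, hA⟩ := A.2
  have hA' : A.val = X + Complex.I • Y := hA
  have key : ∀ Z ∈ lieAlg K, ⁅X, Z⁆ = 0 ∧ ⁅Y, Z⁆ = 0 := by
    intro Z hZ
    have hZC : Z ∈ lieAlgC K := ⟨Z, hZ, 0, (lieAlg K).zero_mem, by simp⟩
    have h1 := congrArg KC.val (h (⟨Z, hZC⟩ : ↥(lieAlgC K)))
    have h2 : ⁅X, Z⁆ + Complex.I • ⁅Y, Z⁆ = 0 := by
      have h3 : ⁅X + Complex.I • Y, Z⁆ = 0 := by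
        rw [← hA']; exact h1
      rwa [add_lie, smul_lie] at h3
    have hs1 := star_of_mem_lieAlg K ((lieAlg K).lie_mem hX hZ)
    have hs2 := star_of_mem_lieAlg K ((lieAlg K).lie_mem hY hZ)
    have h4 := congrArg star h2
    rw [star_add, star_smul, hs1, hs2, star_zero] at h4
    have h5 : -⁅X, Z⁆ + Complex.I • ⁅Y, Z⁆ = 0 := by
      rwa [Complex.star_def, Complex.conj_I, neg_smul, smul_neg, neg_neg] at h4
    have hX0 : ⁅X, Z⁆ = 0 := by
      have h6 : (⁅X, Z⁆ + Complex.I • ⁅Y, Z⁆) - (-⁅X, Z⁆ + Complex.I • ⁅Y, Z⁆) = 0 := by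
        rw [h2, h5, sub_zero]
      have h7 : (2 : ℂ) • ⁅X, Z⁆ = 0 := by
        rw [two_smul]
        rw [← h6]
        abel
      exact (smul_eq_zero.1 h7).resolve_left two_ne_zero
    refine ⟨hX0, ?_⟩
    rw [hX0, zero_add] at h2
    simpa using h2
  have hc : ∀ W (hW : W ∈ lieAlg K), (∀ Z ∈ lieAlg K, ⁅W, Z⁆ = 0) → W = 0 := by
    intro W hW hWZ
    have hm : (⟨W, hW⟩ : lieAlg K) ∈ LieAlgebra.center ℝ (lieAlg K) := by
      rw [LieModule.mem_maxTrivSubmodule]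
      intro Z
      rw [← lie_skew, neg_eq_zero]
      exact Subtype.ext (hWZ Z Z.2)
    rw [LieAlgebra.center_eq_bot] at hm
    exact congrArg Subtype.val ((LieSubmodule.mem_bot _).1 hm)
  apply KC.val_injective
  rw [hA', hc X hX fun Z hZ => (key Z hZ).1, hc Y hY fun Z hZ => (key Z hZ).2]
  rw [smul_zero, add_zero]
  rfl

/-- The Hermitian inner product `⟨A, B⟩ = -κ(Ā, B) = κ(A*, B)` on `𝔨_ℂ` induced by the Killing form
`κ`, where `Ā = -A*` is the conjugate of `A` with respect to `𝔨`. It extends `-κ` on `𝔨`. -/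
@[reducible]
def killingCore (K : Subgroup (UN N)) [LieAlgebra.IsKilling ℝ (lieAlg K)] :
    InnerProductSpace.Core ℂ (KC K) where
  inner := fun A B => killingForm ℂ (KC K) A.conjT B
  conj_inner_symm := fun A B => by
    obtain ⟨n, b, hb⟩ := exists_killing_sum K
    rw [hb, hb, map_sum]
    refine Finset.sum_congr rfl fun i _ => ?_
    generalize (⁅A, b i⁆ : KC K).val = P
    generalize (⁅B, b i⁆ : KC K).val = Q
    change star (Matrix.trace (Matrix.conjTranspose Q * P)) = _
    rw [← Matrix.trace_conjTranspose, Matrix.conjTranspose_mul,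
      Matrix.conjTranspose_conjTranspose]
    rfl
  re_inner_nonneg := fun A => by
    obtain ⟨n, b, hb⟩ := exists_killing_sum K
    rw [hb, map_sum]
    refine Finset.sum_nonneg fun i _ => ?_
    have := (Matrix.posSemidef_conjTranspose_mul_self (⁅A, b i⁆ : KC K).val).trace_nonneg
    exact (Complex.le_def.1 this).1
  add_left := fun A B C => by rw [KC.conjT_add, map_add]; rfl
  smul_left := fun A B z => by rw [KC.conjT_smul, map_smul]; rfl
  definite := fun A h => by
    obtain ⟨n, b, hb⟩ := exists_killing_sum K
    rw [hb] at h
    have h0 := (Finset.sum_eq_zero_iff_of_nonneg fun i _ =>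
      (Matrix.posSemidef_conjTranspose_mul_self (⁅A, b i⁆ : KC K).val).trace_nonneg).1 h
    apply KC.eq_zero_of_lie
    intro B
    have h1 : LieAlgebra.ad ℂ (KC K) A = 0 := by
      refine b.ext fun i => KC.val_injective ?_
      exact Matrix.trace_conjTranspose_mul_self_eq_zero_iff.1 (h0 i (Finset.mem_univ i))
    exact LinearMap.congr_fun h1 B

instance (K : Subgroup (UN N)) [LieAlgebra.IsKilling ℝ (lieAlg K)] :
    NormedAddCommGroup (KC K) := (killingCore K).toNormedAddCommGroup

instance (K : Subgroup (UN N)) [LieAlgebra.IsKilling ℝ (lieAlg K)] :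
    InnerProductSpace ℂ (KC K) := InnerProductSpace.ofCore (killingCore K).toCore

instance (K : Subgroup (UN N)) [LieAlgebra.IsKilling ℝ (lieAlg K)] : CompleteSpace (KC K) :=
  FiniteDimensional.complete ℂ (KC K)

end LieAlgebra

/-! ## The Hilbert–Schmidt Grassmannian of `L²(S¹, V)` -/

instance : Fact (0 < 2 * π) := ⟨Real.two_pi_pos⟩

/-- The circle `S¹ = ℝ / 2πℤ`; the coordinate `z = e^{iθ}` is `fourier 1 θ` and `z ^ k` is
`fourier k θ`. -/
abbrev Circ : Type := AddCircle (2 * π)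

/-- The normalized Lebesgue measure `dθ / 2π` on the circle. -/
abbrev circMeasure : Measure Circ := AddCircle.haarAddCircle

section HilbertSchmidt

variable {E F : Type} [NormedAddCommGroup E] [InnerProductSpace ℂ E]
  [NormedAddCommGroup F] [InnerProductSpace ℂ F]

/-- The square of the Hilbert–Schmidt norm, `∑ ‖T eᵢ‖²` over an orthonormal basis, written as the
supremum over all finite orthonormal families. -/
def hsNormSq (T : E →L[ℂ] F) : ℝ≥0∞ :=
  ⨆ (s : Finset E) (_ : Orthonormal ℂ (fun x : s => (x : E))), ∑ x ∈ s, ‖T x‖ₑ ^ 2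

/-- Hilbert–Schmidt operators. -/
def IsHilbertSchmidt (T : E →L[ℂ] F) : Prop := hsNormSq T < ∞

/-- `τ = tr(X* Y)`: the trace of `X* Y`, computed as `∑ ⟨eᵢ, X* Y eᵢ⟩ = ∑ ⟨X eᵢ, Y eᵢ⟩`, exists and
equals `τ` in every Hilbert basis. -/
def HasTraceAdjointMul (X Y : E →L[ℂ] F) (τ : ℂ) : Prop :=
  ∀ (ι : Type) (b : HilbertBasis ι ℂ E), HasSum (fun i => ⟪X (b i), Y (b i)⟫_ℂ) τ

/-- `w = ω_HS(X, Y) = -i tr(X* Y - Y* X)`. On `HS(W, Wᗮ)` this is the Hilbert–Schmidt symplectic form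
on the tangent space of the Grassmannian at `W`. -/
def HasOmegaHS (X Y : E →L[ℂ] F) (w : ℂ) : Prop :=
  ∃ τ σ : ℂ, HasTraceAdjointMul X Y τ ∧ HasTraceAdjointMul Y X σ ∧ w = -Complex.I * (τ - σ)

end HilbertSchmidt

section Grassmannian

variable (V : Type) [NormedAddCommGroup V] [InnerProductSpace ℂ V] [CompleteSpace V]

/-- The Hilbert space `L²(S¹, V)`. -/
abbrev LTwo : Type := Lp V 2 circMeasure

/-- The closed span `H₊` of the functions `ε z ^ k` with `k ≥ 0` and `ε ∈ V`. -/
def hPlus : Submodule ℂ (LTwo V) :=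
  (Submodule.span ℂ {f : LTwo V | ∃ (k : ℕ) (ε : V),
    (f : Circ → V) =ᵐ[circMeasure] fun θ => fourier (k : ℤ) θ • ε}).topologicalClosure

instance : CompleteSpace (hPlus V) := by
  unfold hPlus; infer_instance

/-- The Grassmannian `Gr(H)`: closed subspaces `W` of `H = H₊ ⊕ H₋`, where `H₋ = H₊ᗮ`, such that
`pr₊ : W → H₊` is Fredholm and `pr₋ : W → H₋` is Hilbert–Schmidt. -/
def Gr : Set (Submodule ℂ (LTwo V)) :=
  {W | IsClosed (W : Set (LTwo V)) ∧
    ((hPlus V).orthogonalProjectionOnto ∘L W.subtypeL).IsFredholm ∧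
    IsHilbertSchmidt ((hPlus V)ᗮ.orthogonalProjectionOnto ∘L W.subtypeL)}

variable {V}

/-- The subspace `z ^ k W = {z ^ k f : f ∈ W}`. -/
def zPowMul (k : ℤ) (W : Submodule ℂ (LTwo V)) : Submodule ℂ (LTwo V) where
  carrier := {g | ∃ f ∈ W, (g : Circ → V) =ᵐ[circMeasure] fun θ => fourier k θ • f θ}
  zero_mem' := ⟨0, W.zero_mem, by
    filter_upwards [Lp.coeFn_zero V 2 circMeasure] with θ h
    rw [h]; simp⟩
  add_mem' := by
    rintro g g' ⟨f, hf, h⟩ ⟨f', hf', h'⟩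
    refine ⟨f + f', W.add_mem hf hf', ?_⟩
    filter_upwards [h, h', Lp.coeFn_add g g', Lp.coeFn_add f f'] with θ h1 h2 h3 h4
    rw [h3, h4, Pi.add_apply, Pi.add_apply, h1, h2, smul_add]
  smul_mem' := by
    rintro c g ⟨f, hf, h⟩
    refine ⟨c • f, W.smul_mem c hf, ?_⟩
    filter_upwards [h, Lp.coeFn_smul c g, Lp.coeFn_smul c f] with θ h1 h2 h3
    rw [h2, h3, Pi.smul_apply, Pi.smul_apply, h1, smul_comm]

variable (V)

/-- `Gr_{0,m}(H)`: the `W ∈ Gr(H)` with `z ^ m H₊ ⊆ W ⊆ z ^ (-m) H₊`. -/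
def GrZeroM (m : ℕ) : Set (Submodule ℂ (LTwo V)) :=
  {W | W ∈ Gr V ∧ zPowMul (m : ℤ) (hPlus V) ≤ W ∧ W ≤ zPowMul (-(m : ℤ)) (hPlus V)}

/-- The algebraic Grassmannian `Gr₀(H)`. -/
def GrZero : Set (Submodule ℂ (LTwo V)) := ⋃ m : ℕ, GrZeroM V m

variable {V}

/-- The graph `{w + T w : w ∈ W}`. The coordinate chart of the Grassmannian around `W` is
`graphOver W T ↦ T`, for `T : W → Wᗮ` Hilbert–Schmidt. -/
def graphOver (W : Submodule ℂ (LTwo V)) (T : W →L[ℂ] Wᗮ) : Submodule ℂ (LTwo V) :=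
  LinearMap.range (W.subtype + Wᗮ.subtype ∘ₗ (T : W →ₗ[ℂ] Wᗮ))

/-- The curve `t ↦ U t` of subspaces, passing through `W` at time `0`, has velocity
`D ∈ HS(W, Wᗮ) = T_W Gr(H)` at time `0`: near `0` the subspaces lie in the domain of the chart around
`W`, and the coordinate `T t` is differentiable at `0` in Hilbert–Schmidt norm, with derivative
`D`. -/
def HasGrVelocity (U : ℝ → Submodule ℂ (LTwo V)) (W : Submodule ℂ (LTwo V))
    (D : W →L[ℂ] Wᗮ) : Prop :=
  U 0 = W ∧ IsHilbertSchmidt D ∧ ∃ T : ℝ → (W →L[ℂ] Wᗮ),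
    (∀ᶠ t in 𝓝 (0 : ℝ), IsHilbertSchmidt (T t) ∧ U t = graphOver W (T t)) ∧
    Tendsto (fun t : ℝ => hsNormSq ((t : ℂ)⁻¹ • (T t - T 0) - D)) (𝓝[≠] 0) (𝓝 0)

end Grassmannian

/-! ## Algebraic based loops -/

section Loops

variable {N : ℕ} (K : Subgroup (UN N))

/-- `F` is a matrix-valued Laurent polynomial `∑_{|k| ≤ m} A_k z ^ k` on the circle. -/
def IsLaurent (m : ℕ) (F : Circ → Mat N) : Prop :=
  ∃ A : ℤ → Mat N, ∀ θ, F θ = ∑ k ∈ Finset.Icc (-(m : ℤ)) m, fourier k θ • A k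

theorem IsLaurent.mono {m m' : ℕ} (h : m ≤ m') {F : Circ → Mat N} (hF : IsLaurent m F) :
    IsLaurent m' F := by
  obtain ⟨A, hA⟩ := hF
  refine ⟨fun k => if k ∈ Finset.Icc (-(m : ℤ)) m then A k else 0, fun θ => ?_⟩
  rw [hA θ]
  have hs : Finset.Icc (-(m : ℤ)) m ⊆ Finset.Icc (-(m' : ℤ)) m' :=
    Finset.Icc_subset_Icc (by omega) (by omega)
  rw [← Finset.sum_subset hs]
  · exact Finset.sum_congr rfl fun k hk => by simp only [if_pos hk]
  · intro k _ hk
    simp only [if_neg hk, smul_zero]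

/-- `Ω_{alg,m} K`: the based loops in `K` that are Laurent polynomials of degree at most `m`. -/
def OmegaAlgM (m : ℕ) : Set (Circ → UN N) :=
  {γ | (∀ θ, γ θ ∈ K) ∧ γ 0 = 1 ∧ IsLaurent m fun θ => (γ θ : Mat N)}

/-- The algebraic based loop group `Ω_alg K`. -/
def OmegaAlg : Set (Circ → UN N) := ⋃ m : ℕ, OmegaAlgM K m

/-- The Lie algebra of `Ω_alg K`: Laurent polynomial loops in `𝔨` that vanish at the base point.
Left translation identifies it with the tangent space of `Ω_alg K` at each `γ`; the element `X` stands
for the tangent vector `γ X`. -/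
def OmegaAlgLie : Submodule ℝ (Circ → lieAlg K) where
  carrier := {X | X 0 = 0 ∧ ∃ m, IsLaurent m fun θ => (X θ : Mat N)}
  zero_mem' := ⟨rfl, 0, fun _ => 0, fun θ => by simp⟩
  add_mem' := by
    rintro X Y ⟨hX, m, hm⟩ ⟨hY, n, hn⟩
    refine ⟨by simp [hX, hY], max m n, ?_⟩
    obtain ⟨A, hA⟩ := hm.mono (le_max_left m n)
    obtain ⟨B, hB⟩ := hn.mono (le_max_right m n)
    refine ⟨fun k => A k + B k, fun θ => ?_⟩
    simp only [smul_add, Finset.sum_add_distrib, ← hA, ← hB]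
    rfl
  smul_mem' := by
    rintro r X ⟨hX, m, A, hA⟩
    refine ⟨by simp [hX], m, fun k => r • A k, fun θ => ?_⟩
    simp only [smul_comm _ r, ← Finset.smul_sum, ← hA]
    rfl

/-- The curve `c` in `Ω_alg K` passes through `γ` at time `0` with velocity `γ X`: near time `0` it
stays in one of the `Ω_{alg,m} K` and it is differentiable at `0`. For Laurent polynomials of bounded
degree, differentiability at each point of the circle is differentiability of the coefficients. -/
def HasLoopVelocity (c : ℝ → Circ → UN N) (γ : Circ → UN N) (X : OmegaAlgLie K) : Prop :=
  c 0 = γ ∧ (∃ m, ∀ᶠ t in 𝓝 (0 : ℝ), c t ∈ OmegaAlgM K m) ∧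
    ∀ θ, HasDerivAt (fun t => (c t θ : Mat N)) ((γ θ : Mat N) * (X.1 θ : Mat N)) 0

/-- The symplectic form `ω_{ΩK}(X, Y) = (1/2π) ∫₀^{2π} ⟨X, Y'⟩ dθ`, where `⟨·, ·⟩ = -κ` is the inner
product on `𝔨` given by the Killing form `κ`. The form is invariant under left translations, hence at
each `γ` its value on `γ X` and `γ Y` is given by this formula. -/
def omegaLoop (X Y : OmegaAlgLie K) : ℝ :=
  (2 * π)⁻¹ * ∫ θ in (0 : ℝ)..(2 * π),
    -killingForm ℝ (lieAlg K) (X.1 (θ : Circ)) (deriv (fun s : ℝ => Y.1 (s : Circ)) θ)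

variable [LieAlgebra.IsKilling ℝ (lieAlg K)]

/-- The Hilbert space `H = H^𝔨 = L²(S¹, 𝔨_ℂ)`, with the inner product induced by the Killing form. -/
abbrev HK : Type := LTwo (KC K)

variable {K}

theorem HK.val_add (f g : HK K) :
    ∀ᵐ θ ∂circMeasure, ((f + g : HK K) θ).val = (f θ).val + (g θ).val := by
  filter_upwards [Lp.coeFn_add f g] with θ h
  rw [h]; rfl

theorem HK.val_smul (c : ℂ) (f : HK K) :
    ∀ᵐ θ ∂circMeasure, ((c • f : HK K) θ).val = c • (f θ).val := by
  filter_upwards [Lp.coeFn_smul c f] with θ h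
  rw [h]; rfl

/-- The subspace `γ · W = {Ad_γ f : f ∈ W}`, where `(Ad_γ f)(z) = γ(z) f(z) γ(z)⁻¹`. -/
def loopAct (γ : Circ → UN N) (W : Submodule ℂ (HK K)) : Submodule ℂ (HK K) where
  carrier := {g | ∃ f ∈ W, ∀ᵐ θ ∂circMeasure,
    (g θ).val = (γ θ : Mat N) * (f θ).val * ((γ θ)⁻¹ : UN N)}
  zero_mem' := ⟨0, W.zero_mem, by
    filter_upwards [Lp.coeFn_zero (KC K) 2 circMeasure] with θ h
    rw [h]
    change (0 : Mat N) = _ * (0 : Mat N) * _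
    rw [mul_zero, zero_mul]⟩
  add_mem' := by
    rintro g g' ⟨f, hf, h⟩ ⟨f', hf', h'⟩
    refine ⟨f + f', W.add_mem hf hf', ?_⟩
    filter_upwards [h, h', HK.val_add g g', HK.val_add f f'] with θ h1 h2 h3 h4
    rw [h3, h4, h1, h2, mul_add, add_mul]
  smul_mem' := by
    rintro c g ⟨f, hf, h⟩
    refine ⟨c • f, W.smul_mem c hf, ?_⟩
    filter_upwards [h, HK.val_smul c g, HK.val_smul c f] with θ h1 h2 h3
    rw [h2, h3, h1, mul_smul_comm, smul_mul_assoc]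

variable (K)

/-- The map `φ : γ ↦ γ · H₊`. -/
def phi (γ : Circ → UN N) : Submodule ℂ (HK K) := loopAct γ (hPlus (KC K))

/-- `D` is the differential of `φ` at `γ`, as a real linear map from the tangent space of `Ω_alg K` to
`HS(W, Wᗮ)`, `W = φ(γ)`: along every curve in `Ω_alg K` with velocity `γ X` the image curve has
velocity `D X`; and `D X` is `w ↦ pr_{Wᗮ} [Ad_γ X, w]`. -/
def IsDifferentialPhi (γ : Circ → UN N)
    (D : OmegaAlgLie K →ₗ[ℝ] (phi K γ →L[ℂ] (phi K γ)ᗮ)) : Prop :=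
  ∀ X : OmegaAlgLie K,
    (∀ c : ℝ → Circ → UN N, HasLoopVelocity K c γ X →
      HasGrVelocity (fun t => phi K (c t)) (phi K γ) (D X)) ∧
    ∀ w : phi K γ, ∃ u : phi K γ, ∀ᵐ θ ∂circMeasure,
      ((D X w + u : HK K) θ).val =
        ⁅(γ θ : Mat N) * (X.1 θ : Mat N) * ((γ θ)⁻¹ : UN N), ((w : HK K) θ).val⁆

/-- The `k`-th Fourier coefficient `A_k ∈ 𝔨_ℂ` of a loop `X` in `𝔨`, so that
`X(θ) = ∑ A_k e^{ikθ}`. -/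
def loopCoeff (X : OmegaAlgLie K) (k : ℤ) : KC K :=
  fourierCoeff (fun θ : Circ => KC.ofReal (X.1 θ)) k

/-- `tr(A* B)` for `A, B ∈ 𝔨_ℂ` acting on the Hermitian space `𝔨_ℂ` by the adjoint
representation. -/
def traceAd (A B : KC K) : ℂ :=
  LinearMap.trace ℂ (KC K)
    (LinearMap.adjoint (LieAlgebra.ad ℂ (KC K) A) ∘ₗ LieAlgebra.ad ℂ (KC K) B)

end Loops

end LoopGr

end

/-! Everything happens on Fourier modes. Conjugation by a unitary `k ∈ K` is an automorphism of
`𝔨_ℂ` commuting with `A ↦ A*`, so it preserves the Killing inner product, and `Ad_γ` is a unitary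
operator on `L²(S¹, 𝔨_ℂ)`. If `γ` has degree `m`, then `Ad_γ` is a Laurent polynomial of degree
`2m`, which moves modes by at most `2m`. Hence `W = Ad_γ H₊` lies between `z ^ n H₊` and `z ^ (-n)
H₊` for `n = 2m`, and for such `W` all the relevant projections agree with invertible or zero maps
up to finite rank.

Injectivity. If `γ` and `δ` have the same image, then `g = δ⁻¹γ` satisfies `Ad_g H₊ = H₊`. Applied
to constants, `Ad_g` produces no negative modes, and by unitarity no positive ones
(`adLin_eq_self_of_phi_eq`). So `Ad_g` is constant, equal to `1` at the base point. Then `g⁻¹g'` is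
a central element of `𝔨`, which vanishes because the Killing form is non-degenerate, and `g = 1`
(`eq_one_of_centralizes`).

Differential. Along a curve `c t` of bounded degree, `R t = Ad_{c t} Ad_γ⁻¹` carries `W` to `φ(c
t)`. The Fourier coefficients of a Laurent polynomial of degree `n` are linear combinations of its
values at `2n + 1` points, so pointwise differentiability of `c` makes `R` differentiable in
operator norm. The chart coordinate of `R t W` is `b a⁻¹`, where `a` and `b` are the components of
`R t` on `W` in `W` and `Wᗮ`. Its range stays in a fixed finite-dimensional space, where
operator-norm convergence implies Hilbert–Schmidt convergence (`exists_chart_of_tendsto_slope`).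

Symplectic form. By unitarity the trace is computed on `H₊`, where the differential sends `z ^ k ε`
to `∑ z ^ (k + l) [A_l, ε]` over `l < -k` (`phiDiff_mono`). For `l < 0` there are `-l` values `k ≥
0` with `k + l < 0`, so `tr(D_X* D_Y) = ∑_{l < 0} (-l) ⟨A_l, B_l⟩`. The reality condition `A_{-l} =
-A_l*` turns the other trace into the sum over `l > 0`, and the difference is `i ∑ l ⟨A_l, B_l⟩`.
Parseval gives the same value for the integral of `⟨X, Y'⟩`, and `⟨A, B⟩ = tr(ad(A)* ad(B))`. -/

set_option linter.unusedSectionVars false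

noncomputable section

namespace LoopGr

/-! ### Laurent polynomials as continuous functions on the circle -/

section Trig

variable {E : Type} [NormedAddCommGroup E] [NormedSpace ℂ E]

/-- The function `z ^ k a` on the circle, as a continuous linear map in `a`. -/
def trig (k : ℤ) : E →L[ℂ] C(Circ, E) :=
  LinearMap.mkContinuous
    { toFun := fun a => ⟨fun θ => fourier k θ • a, by fun_prop⟩
      map_add' := fun a b => by ext θ; exact smul_add _ _ _
      map_smul' := fun c a => by ext θ; exact smul_comm _ _ _ } 1 fun a => by
    rw [ContinuousMap.norm_le _ (by positivity)]
    intro θ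
    change ‖fourier k θ • a‖ ≤ _
    rw [norm_smul, one_mul]
    refine mul_le_of_le_one_left (norm_nonneg _) ?_
    rw [fourier_apply, Circle.norm_coe]

theorem trig_apply (k : ℤ) (a : E) (θ : Circ) : trig k a θ = fourier k θ • a := rfl

/-- The Laurent polynomial `∑_{|k| ≤ n} A_k z ^ k`. -/
def lpoly (n : ℕ) (A : ℤ → E) : C(Circ, E) := ∑ k ∈ Finset.Icc (-(n : ℤ)) n, trig k (A k)

theorem lpoly_apply (n : ℕ) (A : ℤ → E) (θ : Circ) :
    lpoly n A θ = ∑ k ∈ Finset.Icc (-(n : ℤ)) n, fourier k θ • A k := by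
  rw [lpoly, ContinuousMap.sum_apply]; rfl

theorem integral_fourier (k : ℤ) : ∫ θ, fourier k θ ∂circMeasure = if k = 0 then 1 else 0 := by
  have h := congrFun (fourierCoeff_fourier (T := 2 * π) k) 0
  rw [fourierCoeff] at h
  simp only [neg_zero, fourier_zero, one_smul, Pi.single_apply] at h
  rw [h]
  simp only [eq_comm]

end Trig

/-! ### Fourier modes and multiplication operators on `L²(S¹, V)` -/

section Hardy

variable {V : Type} [NormedAddCommGroup V] [InnerProductSpace ℂ V] [CompleteSpace V]

/-- The element `ε z ^ k` of `L²(S¹, V)`. -/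
def mono (k : ℤ) : V →L[ℂ] LTwo V := ContinuousMap.toLp 2 circMeasure ℂ ∘L trig k

theorem coeFn_mono (k : ℤ) (ε : V) :
    (mono k ε : Circ → V) =ᵐ[circMeasure] fun θ => fourier k θ • ε :=
  ContinuousMap.coeFn_toLp circMeasure (trig k ε)

theorem inner_mono_left (k : ℤ) (ε : V) (f : LTwo V) :
    ⟪mono k ε, f⟫_ℂ = ∫ θ, fourier (-k) θ * ⟪ε, f θ⟫_ℂ ∂circMeasure := by
  rw [L2.inner_def]
  refine integral_congr_ae ?_
  filter_upwards [coeFn_mono k ε] with θ h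
  rw [h, inner_smul_left, fourier_neg]

theorem inner_mono_mono (k l : ℤ) (ε δ : V) :
    ⟪mono k ε, mono l δ⟫_ℂ = if k = l then ⟪ε, δ⟫_ℂ else 0 := by
  have h : ∀ᵐ θ ∂circMeasure, fourier (-k) θ * ⟪ε, (mono l δ : LTwo V) θ⟫_ℂ =
      fourier (l - k) θ * ⟪ε, δ⟫_ℂ := by
    filter_upwards [coeFn_mono l δ] with θ h
    rw [h, inner_smul_right, ← mul_assoc, ← fourier_add, neg_add_eq_sub]
  rw [inner_mono_left, integral_congr_ae h, integral_mul_const, integral_fourier]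
  by_cases hkl : k = l
  · simp [hkl]
  · rw [if_neg hkl, if_neg (by omega), zero_mul]

/-- The subspace `z ^ n H₊` described by its vanishing Fourier coefficients. -/
def Hge (n : ℤ) : Submodule ℂ (LTwo V) where
  carrier := {f | ∀ l < n, ∀ ε : V, ⟪mono l ε, f⟫_ℂ = 0}
  zero_mem' := fun l _ ε => inner_zero_right _
  add_mem' := fun hf hg l hl ε => by rw [inner_add_right, hf l hl, hg l hl, add_zero]
  smul_mem' := fun c f hf l hl ε => by rw [inner_smul_right, hf l hl, mul_zero]

theorem mem_Hge {n : ℤ} {f : LTwo V} : f ∈ Hge n ↔ ∀ l < n, ∀ ε : V, ⟪mono l ε, f⟫_ℂ = 0 := Iff.rfl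

theorem isClosed_Hge (n : ℤ) : IsClosed ((Hge n : Submodule ℂ (LTwo V)) : Set (LTwo V)) := by
  have : ((Hge n : Submodule ℂ (LTwo V)) : Set (LTwo V)) = ⋂ (l) (_ : l < n) (ε : V), {f | ⟪mono l ε, f⟫_ℂ = 0} := by
    ext f; simp [mem_Hge]
  rw [this]
  refine isClosed_iInter fun l => isClosed_iInter fun _ => isClosed_iInter fun ε => ?_
  exact isClosed_eq (by fun_prop) continuous_const

theorem mono_mem_Hge {n k : ℤ} (h : n ≤ k) (ε : V) : mono k ε ∈ Hge (V := V) n := by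
  intro l hl δ
  rw [inner_mono_mono, if_neg (by omega)]

/-- Multiplication by a continuous operator-valued function. -/
def mulOp : C(Circ, V →L[ℂ] V) →L[ℂ] LTwo V →L[ℂ] LTwo V :=
  (ContinuousLinearMap.id ℂ (V →L[ℂ] V)).holderL circMeasure ∞ 2 2 ∘L
    ContinuousMap.toLp ∞ circMeasure ℂ

theorem coeFn_mulOp (G : C(Circ, V →L[ℂ] V)) (f : LTwo V) :
    (mulOp G f : Circ → V) =ᵐ[circMeasure] fun θ => G θ (f θ) := by
  have h1 := (ContinuousLinearMap.id ℂ (V →L[ℂ] V)).coeFn_holder (r := 2)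
    (ContinuousMap.toLp ∞ circMeasure ℂ G) f
  filter_upwards [h1, ContinuousMap.coeFn_toLp (p := ∞) (𝕜 := ℂ) circMeasure G] with θ h2 h3
  rw [← h3]
  exact h2

theorem mulOp_eq_of_ae {G : C(Circ, V →L[ℂ] V)} {f g : LTwo V}
    (h : ∀ᵐ θ ∂circMeasure, g θ = G θ (f θ)) : mulOp G f = g := by
  refine Lp.ext ?_
  filter_upwards [h, coeFn_mulOp G f] with θ h1 h2
  rw [h1, h2]

theorem mulOp_mul (G G' : C(Circ, V →L[ℂ] V)) (f : LTwo V) :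
    mulOp (G * G') f = mulOp G (mulOp G' f) := by
  refine mulOp_eq_of_ae ?_
  filter_upwards [coeFn_mulOp G (mulOp G' f), coeFn_mulOp G' f] with θ h1 h2
  rw [h1, h2]; rfl

theorem mulOp_one (f : LTwo V) : mulOp (1 : C(Circ, V →L[ℂ] V)) f = f :=
  mulOp_eq_of_ae (Eventually.of_forall fun _ => rfl)

theorem mulOp_trig_mono (k l : ℤ) (A : V →L[ℂ] V) (ε : V) :
    mulOp (trig k A) (mono l ε) = mono (k + l) (A ε) := by
  refine mulOp_eq_of_ae ?_
  filter_upwards [coeFn_mono l ε, coeFn_mono (k + l) (A ε)] with θ h1 h2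
  rw [h1, h2, trig_apply, smul_apply, map_smul, smul_smul, fourier_add]

theorem mulOp_lpoly_mono (n : ℕ) (A : ℤ → V →L[ℂ] V) (l : ℤ) (ε : V) :
    mulOp (lpoly n A) (mono l ε) = ∑ k ∈ Finset.Icc (-(n : ℤ)) n, mono (k + l) (A k ε) := by
  rw [lpoly, map_sum, sum_apply]
  exact Finset.sum_congr rfl fun k _ => mulOp_trig_mono k l (A k) ε

theorem inner_mono_mulOp_trig (k l : ℤ) (A : V →L[ℂ] V) (ε : V) (f : LTwo V) :
    ⟪mono l ε, mulOp (trig k A) f⟫_ℂ = ⟪mono (l - k) (ContinuousLinearMap.adjoint A ε), f⟫_ℂ := by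
  rw [inner_mono_left, inner_mono_left]
  refine integral_congr_ae ?_
  filter_upwards [coeFn_mulOp (trig k A) f] with θ h
  rw [h, trig_apply, smul_apply, inner_smul_right, ← mul_assoc, ← fourier_add,
    ContinuousLinearMap.adjoint_inner_left, neg_sub, neg_add_eq_sub]

theorem mulOp_trig_mem_Hge (k : ℤ) (A : V →L[ℂ] V) {m n : ℤ} (hmn : n ≤ m + k) {f : LTwo V}
    (hf : f ∈ Hge m) : mulOp (trig k A) f ∈ Hge n := by
  intro l hl ε
  rw [inner_mono_mulOp_trig]
  exact hf _ (by omega) _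

/-- Each term `z ^ k A` with `k ≥ -d` lowers the filtration by at most `d`. All later inclusions
between `W` and the `z ^ n H₊` rest on this count. -/
theorem mulOp_lpoly_mem_Hge (d : ℕ) (A : ℤ → V →L[ℂ] V) {m n : ℤ} (hmn : n ≤ m - d) {f : LTwo V}
    (hf : f ∈ Hge m) : mulOp (lpoly d A) f ∈ Hge n := by
  rw [lpoly, map_sum, sum_apply]
  refine Submodule.sum_mem _ fun k hk => mulOp_trig_mem_Hge k (A k) ?_ hf
  have := (Finset.mem_Icc.1 hk).1
  omega

end Hardy

/-! ### The filtration by `z ^ n H₊` for finite-dimensional `V` -/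

section HardyFin

variable {V : Type} [NormedAddCommGroup V] [InnerProductSpace ℂ V] [FiniteDimensional ℂ V]
  [CompleteSpace V]

/-- Each scalar component `⟪ε, f⟫` has zero Fourier coefficients, hence vanishes almost everywhere.
A finite basis of `V` leaves only finitely many null sets to discard. -/
theorem eq_zero_of_inner_mono {f : LTwo V} (h : ∀ k (ε : V), ⟪mono k ε, f⟫_ℂ = 0) : f = 0 := by
  have key : ∀ ε : V, ∀ᵐ θ ∂circMeasure, ⟪ε, f θ⟫_ℂ = 0 := by
    intro ε
    let g : Lp ℂ 2 circMeasure := (innerSL ℂ ε).compLp f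
    have hg := (innerSL ℂ ε).coeFn_compLp f
    have hg0 : g = 0 := by
      apply (fourierBasis (T := 2 * π)).repr.injective
      rw [map_zero]
      ext k
      rw [fourierBasis_repr, fourierCoeff]
      have : ∫ θ, fourier (-k) θ • (g θ : ℂ) ∂circMeasure = ⟪mono k ε, f⟫_ℂ := by
        rw [inner_mono_left]
        refine integral_congr_ae ?_
        filter_upwards [hg] with θ hθ
        rw [show g θ = _ from hθ]; rfl
      rw [this, h]; rfl
    filter_upwards [hg, Lp.coeFn_zero ℂ 2 circMeasure] with θ h1 h2
    have h3 : g θ = ⟪ε, f θ⟫_ℂ := h1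
    rw [← h3, hg0, h2]; rfl
  let b := stdOrthonormalBasis ℂ V
  refine Lp.ext ?_
  filter_upwards [ae_all_iff.2 fun i => key (b i), Lp.coeFn_zero V 2 circMeasure] with θ h1 h2
  rw [h2]
  refine InnerProductSpace.ext_inner_left_basis b.toBasis fun i => ?_
  rw [OrthonormalBasis.coe_toBasis, h1 i]
  simp

theorem hPlus_le_Hge : hPlus V ≤ Hge 0 := by
  refine Submodule.topologicalClosure_minimal _ ?_ (isClosed_Hge 0)
  rw [Submodule.span_le]
  rintro f ⟨k, ε, hf⟩
  have : f = mono (k : ℤ) ε := Lp.ext (hf.trans (coeFn_mono _ _).symm)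
  rw [this]
  exact mono_mem_Hge (by omega) ε

theorem mono_mem_hPlus {k : ℤ} (hk : 0 ≤ k) (ε : V) : mono k ε ∈ hPlus V := by
  lift k to ℕ using hk
  exact Submodule.le_topologicalClosure _ (Submodule.subset_span ⟨k, ε, coeFn_mono _ _⟩)

theorem mem_hPlus_orthogonal {f : LTwo V} :
    f ∈ (hPlus V)ᗮ ↔ ∀ k : ℤ, 0 ≤ k → ∀ ε : V, ⟪mono k ε, f⟫_ℂ = 0 := by
  constructor
  · intro hf k hk ε
    exact (Submodule.mem_orthogonal _ _).1 hf _ (mono_mem_hPlus hk ε)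
  · intro hf
    rw [hPlus, Submodule.orthogonal_closure, Submodule.mem_orthogonal]
    intro g hg
    induction hg using Submodule.span_induction with
    | mem g hg =>
      obtain ⟨k, ε, hg⟩ := hg
      have : g = mono (k : ℤ) ε := Lp.ext (hg.trans (coeFn_mono _ _).symm)
      rw [this]
      exact hf _ (by omega) ε
    | zero => exact inner_zero_left _
    | add x y _ _ hx hy => rw [inner_add_left, hx, hy, add_zero]
    | smul c x _ hx => rw [inner_smul_left, hx, mul_zero]

theorem mono_mem_hPlus_orthogonal {k : ℤ} (hk : k < 0) (ε : V) : mono k ε ∈ (hPlus V)ᗮ := by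
  rw [mem_hPlus_orthogonal]
  intro l hl δ
  rw [inner_mono_mono, if_neg (by omega)]

/-- For `f` in `Hge 0`, the difference `f - pr₊ f` is orthogonal to every mode: to the negative ones
because both terms are, to the others because it is orthogonal to `H₊`. -/
theorem hPlus_eq_Hge : hPlus V = Hge 0 := by
  refine le_antisymm hPlus_le_Hge fun f hf => ?_
  have h1 := (hPlus V).starProjection_apply_mem f
  have h2 := (hPlus V).sub_starProjection_mem_orthogonal f
  have h3 : f - (hPlus V).starProjection f = 0 := by
    refine eq_zero_of_inner_mono fun k ε => ?_
    rcases lt_or_ge k 0 with hk | hk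
    · exact (Hge 0).sub_mem hf (hPlus_le_Hge h1) k hk ε
    · exact mem_hPlus_orthogonal.1 h2 k hk ε
  rw [sub_eq_zero.1 h3]
  exact h1

theorem zPowMul_hPlus (n : ℤ) : zPowMul n (hPlus V) = Hge n := by
  ext g
  rw [hPlus_eq_Hge]
  constructor
  · rintro ⟨f, hf, h⟩
    have : mulOp (trig n 1) f = g := mulOp_eq_of_ae h
    rw [← this]
    exact mulOp_trig_mem_Hge n _ (by omega) hf
  · intro hg
    refine ⟨mulOp (trig (-n) 1) g, mulOp_trig_mem_Hge (-n) _ (by omega) hg, ?_⟩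
    filter_upwards [coeFn_mulOp (trig (-n) 1) g] with θ h
    rw [h, trig_apply, smul_apply, one_apply_eq_self, smul_smul,
      ← fourier_add, add_neg_cancel, fourier_zero, one_smul]

/-- The span of the `ε z ^ k` with `a ≤ k < b`. -/
def box (V : Type) [NormedAddCommGroup V] [InnerProductSpace ℂ V] [CompleteSpace V] (a b : ℤ) :
    Submodule ℂ (LTwo V) :=
  (Finset.Ico a b).sup fun k => LinearMap.range (mono k : V →L[ℂ] LTwo V).toLinearMap

instance (a b : ℤ) : FiniteDimensional ℂ (box V a b) := by
  unfold box; infer_instance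

theorem mono_mem_box {a b k : ℤ} (ha : a ≤ k) (hb : k < b) (ε : V) : mono k ε ∈ box V a b := by
  have : LinearMap.range (mono k : V →L[ℂ] LTwo V).toLinearMap ≤ box V a b :=
    Finset.le_sup (f := fun k => LinearMap.range (mono k : V →L[ℂ] LTwo V).toLinearMap)
      (Finset.mem_Ico.2 ⟨ha, hb⟩)
  exact this ⟨ε, rfl⟩

theorem box_le_Hge (a b : ℤ) : box V a b ≤ Hge a := by
  refine Finset.sup_le fun k hk => ?_
  rintro _ ⟨ε, rfl⟩
  exact mono_mem_Hge (Finset.mem_Ico.1 hk).1 ε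

/-- Modes below `a` are absent from both terms, and subtracting the projection removes those in `[a,
b)`. Thus `Hge a` is finite-dimensional modulo `Hge b`. -/
theorem sub_starProjection_box_mem_Hge {a : ℤ} (b : ℤ) {f : LTwo V} (hf : f ∈ Hge a) :
    f - (box V a b).starProjection f ∈ Hge b := by
  intro k hk ε
  rcases lt_or_ge k a with h | h
  · exact (Hge a).sub_mem hf (box_le_Hge _ _ ((box V a b).starProjection_apply_mem f)) k h ε
  · exact (Submodule.mem_orthogonal _ _).1 ((box V a b).sub_starProjection_mem_orthogonal f) _
      (mono_mem_box h hk ε)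

end HardyFin

/-! ### Hilbert–Schmidt norms, traces and graph charts for operators of finite rank -/

section Operators

variable {E F : Type} [NormedAddCommGroup E] [InnerProductSpace ℂ E] [CompleteSpace E]
  [NormedAddCommGroup F] [InnerProductSpace ℂ F] [CompleteSpace F]

/-- Expand `T x` in an orthonormal basis `g j` of `G`; Bessel's inequality for each `T* (g j)`, of
norm at most `‖T‖`, bounds the sum over any orthonormal family. -/
theorem hsNormSq_le {T : E →L[ℂ] F} (G : Submodule ℂ F) [FiniteDimensional ℂ G]
    (h : ∀ x, T x ∈ G) : hsNormSq T ≤ ENNReal.ofReal (Module.finrank ℂ G * ‖T‖ ^ 2) := by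
  refine iSup₂_le fun s hs => ?_
  let g := stdOrthonormalBasis ℂ G
  have h1 : ∀ x, ‖T x‖ ^ 2 = ∑ j, ‖⟪x, ContinuousLinearMap.adjoint T (g j)⟫_ℂ‖ ^ 2 := by
    intro x
    have := g.sum_sq_norm_inner_right (⟨T x, h x⟩ : G)
    rw [Submodule.coe_norm] at this
    rw [← this]
    refine Finset.sum_congr rfl fun j _ => ?_
    rw [ContinuousLinearMap.adjoint_inner_right, ← norm_inner_symm, Submodule.coe_inner]
  have h2 : ∀ j, ∑ x : s, ‖⟪(x : E), ContinuousLinearMap.adjoint T (g j)⟫_ℂ‖ ^ 2 ≤ ‖T‖ ^ 2 := by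
    intro j
    refine (hs.sum_inner_products_le (s := Finset.univ)
      (ContinuousLinearMap.adjoint T (g j : F))).trans ?_
    have h3 := (ContinuousLinearMap.adjoint T).le_opNorm (g j : F)
    have h4 : ‖(g j : F)‖ = 1 := g.orthonormal.1 j
    rw [LinearIsometryEquiv.norm_map, h4, mul_one] at h3
    gcongr
  have h3 : ∑ x ∈ s, ‖T x‖ ^ 2 ≤ Module.finrank ℂ G * ‖T‖ ^ 2 := by
    rw [← Finset.sum_coe_sort s fun x => ‖T x‖ ^ 2]
    simp only [h1]
    rw [Finset.sum_comm]
    refine (Finset.sum_le_sum fun j _ => h2 j).trans ?_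
    simp
  calc ∑ x ∈ s, ‖T x‖ₑ ^ 2 = ENNReal.ofReal (∑ x ∈ s, ‖T x‖ ^ 2) := by
        rw [ENNReal.ofReal_sum_of_nonneg fun _ _ => by positivity]
        refine Finset.sum_congr rfl fun x _ => ?_
        rw [ENNReal.ofReal_pow (norm_nonneg _), ofReal_norm]
    _ ≤ _ := ENNReal.ofReal_le_ofReal h3

theorem isHilbertSchmidt_of_mem {T : E →L[ℂ] F} (G : Submodule ℂ F) [FiniteDimensional ℂ G]
    (h : ∀ x, T x ∈ G) : IsHilbertSchmidt T :=
  (hsNormSq_le G h).trans_lt ENNReal.ofReal_lt_top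

theorem tendsto_hsNormSq {α : Type} {l : Filter α} {S : α → E →L[ℂ] F} (h : Tendsto S l (𝓝 0))
    (G : Submodule ℂ F) [FiniteDimensional ℂ G] (hG : ∀ᶠ t in l, ∀ x, S t x ∈ G) :
    Tendsto (fun t => hsNormSq (S t)) l (𝓝 0) := by
  have h1 : Tendsto (fun t => ‖S t‖) l (𝓝 0) := tendsto_zero_iff_norm_tendsto_zero.1 h
  have h2 := ENNReal.tendsto_ofReal ((h1.pow 2).const_mul (Module.finrank ℂ G : ℝ))
  rw [zero_pow two_ne_zero, mul_zero, ENNReal.ofReal_zero] at h2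
  exact tendsto_of_tendsto_of_tendsto_of_le_of_le' tendsto_const_nhds h2
    (Eventually.of_forall fun _ => zero_le) (hG.mono fun t ht => hsNormSq_le G ht)

theorem eq_sum_of_orthonormal {κ : Type} [Fintype κ] {v : κ → E} (hv : Orthonormal ℂ v)
    {X : E →L[ℂ] F} (hX : ∀ x, (∀ a, ⟪v a, x⟫_ℂ = 0) → X x = 0) (x : E) :
    X x = ∑ a, ⟪v a, x⟫_ℂ • X (v a) := by
  have h := hX (x - ∑ a, ⟪v a, x⟫_ℂ • v a) fun a => by
    rw [inner_sub_right, hv.inner_right_fintype, sub_self]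
  rw [map_sub, sub_eq_zero, map_sum] at h
  rw [h]
  simp only [map_smul]

/-- The trace of `X* Y` when `X` and `Y` vanish off the span of a finite orthonormal family. -/
theorem hasTraceAdjointMul_of_orthonormal {κ : Type} [Fintype κ] {v : κ → E}
    (hv : Orthonormal ℂ v) {X Y : E →L[ℂ] F}
    (hX : ∀ x, (∀ a, ⟪v a, x⟫_ℂ = 0) → X x = 0)
    (hY : ∀ x, (∀ a, ⟪v a, x⟫_ℂ = 0) → Y x = 0) :
    HasTraceAdjointMul X Y (∑ a, ⟪X (v a), Y (v a)⟫_ℂ) := by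
  classical
  intro ι b
  have h1 : ∀ i, ⟪X (b i), Y (b i)⟫_ℂ =
      ∑ a, ∑ c, ⟪v c, b i⟫_ℂ * ⟪b i, v a⟫_ℂ * ⟪X (v a), Y (v c)⟫_ℂ := by
    intro i
    rw [eq_sum_of_orthonormal hv hX (b i), eq_sum_of_orthonormal hv hY (b i), sum_inner]
    refine Finset.sum_congr rfl fun a _ => ?_
    rw [inner_sum]
    refine Finset.sum_congr rfl fun c _ => ?_
    rw [inner_smul_left, inner_smul_right, inner_conj_symm]
    ring
  simp only [h1]
  have h2 : ∑ a, ⟪X (v a), Y (v a)⟫_ℂ = ∑ a, ∑ c, ⟪v c, v a⟫_ℂ * ⟪X (v a), Y (v c)⟫_ℂ := by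
    refine Finset.sum_congr rfl fun a _ => ?_
    simp [orthonormal_iff_ite.1 hv]
  rw [h2]
  -- The sums over `a` and `c` are finite, so only Parseval's identity for each pair `v c`, `v a` in
  -- the Hilbert basis `b` is needed.
  exact hasSum_sum fun a _ => hasSum_sum fun c _ =>
    (b.hasSum_inner_mul_inner (v c) (v a)).mul_right _

/-- Write `R t = a t + b t` on `W`, with values in `W` and `Wᗮ`. Since `a t → 1`, it is invertible
near `0`, and `R t W` is the graph of `b t (a t)⁻¹`. As `b 0 = 0`, the derivative of this product is
that of `b`. The space `G` upgrades operator-norm convergence to Hilbert–Schmidt convergence. -/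
theorem exists_chart_of_tendsto_slope {W : Submodule ℂ E} [CompleteSpace W]
    {R : ℝ → E →L[ℂ] E} {R' : E →L[ℂ] E}
    (hR : Tendsto (fun t : ℝ => (t : ℂ)⁻¹ • (R t - 1)) (𝓝[≠] 0) (𝓝 R')) (hR0 : R 0 = 1)
    (G : Submodule ℂ Wᗮ) [FiniteDimensional ℂ G]
    (hG : ∀ᶠ t in 𝓝 (0 : ℝ), ∀ w ∈ W, Wᗮ.orthogonalProjectionOnto (R t w) ∈ G)
    (hG' : ∀ w ∈ W, Wᗮ.orthogonalProjectionOnto (R' w) ∈ G) :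
    IsHilbertSchmidt (Wᗮ.orthogonalProjectionOnto ∘L R' ∘L W.subtypeL) ∧
    ∃ T : ℝ → (W →L[ℂ] Wᗮ),
      (∀ᶠ t in 𝓝 (0 : ℝ), IsHilbertSchmidt (T t) ∧ W.map (R t).toLinearMap =
        LinearMap.range (W.subtype + Wᗮ.subtype ∘ₗ (T t : W →ₗ[ℂ] Wᗮ))) ∧
      Tendsto (fun t : ℝ => hsNormSq ((t : ℂ)⁻¹ • (T t - T 0) -
        Wᗮ.orthogonalProjectionOnto ∘L R' ∘L W.subtypeL)) (𝓝[≠] 0) (𝓝 0) := by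
  let a : ℝ → W →L[ℂ] W := fun t => W.orthogonalProjectionOnto ∘L R t ∘L W.subtypeL
  let b : ℝ → W →L[ℂ] Wᗮ := fun t => Wᗮ.orthogonalProjectionOnto ∘L R t ∘L W.subtypeL
  let D : W →L[ℂ] Wᗮ := Wᗮ.orthogonalProjectionOnto ∘L R' ∘L W.subtypeL
  have hab : ∀ t (w : W), R t (w : E) = a t w + b t w := fun t w =>
    (W.starProjection_add_starProjection_orthogonal (R t w)).symm
  have hW0 : ∀ w : W, Wᗮ.orthogonalProjectionOnto (w : E) = 0 := fun w =>
    Submodule.orthogonalProjectionOnto_eq_zero_iff.2 (Submodule.le_orthogonal_orthogonal _ w.2)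
  have ha0 : a 0 = 1 := by
    ext1 w
    change W.orthogonalProjectionOnto (R 0 w) = w
    rw [hR0]
    exact W.orthogonalProjectionOnto_mem_subspace_eq_self w
  have hb0 : b 0 = 0 := by
    ext1 w
    change Wᗮ.orthogonalProjectionOnto (R 0 w) = 0
    rw [hR0]
    exact hW0 w
  have hRc : Tendsto R (𝓝 0) (𝓝 1) := by
    have h0 : ContinuousAt R 0 ↔ Tendsto R (𝓝[≠] 0) (𝓝 (R 0)) := continuousWithinAt_compl_self.symm
    rw [← hR0]
    refine h0.2 ?_
    have h1 : Tendsto (fun t : ℝ => (t : ℂ)) (𝓝[≠] 0) (𝓝 0) := by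
      have := Complex.continuous_ofReal.tendsto 0
      rw [Complex.ofReal_zero] at this
      exact this.mono_left nhdsWithin_le_nhds
    -- Differentiability gives continuity: away from `0`, `R t` is `t` times the slope plus `1`.
    have h2 := (h1.smul hR).add_const 1
    rw [zero_smul, zero_add, ← hR0] at h2
    refine h2.congr' ?_
    filter_upwards [self_mem_nhdsWithin] with t ht
    rw [smul_inv_smul₀ (Complex.ofReal_ne_zero.2 ht), hR0, sub_add_cancel]
  have hac : Tendsto a (𝓝 0) (𝓝 1) := by
    have h1 : ContinuousAt R 0 := by rw [ContinuousAt, hR0]; exact hRc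
    have h2 : ContinuousAt a 0 := continuousAt_const.clm_comp (h1.clm_comp continuousAt_const)
    rw [← ha0]
    exact h2
  have hbd : Tendsto (fun t : ℝ => (t : ℂ)⁻¹ • b t) (𝓝[≠] 0) (𝓝 D) := by
    have h1 : Tendsto (fun t : ℝ => Wᗮ.orthogonalProjectionOnto ∘L
        ((t : ℂ)⁻¹ • (R t - 1)) ∘L W.subtypeL) (𝓝[≠] 0) (𝓝 D) :=
      ((ContinuousLinearMap.compL ℂ W E Wᗮ Wᗮ.orthogonalProjectionOnto).continuous.tendsto _).comp
        (((ContinuousLinearMap.compL ℂ W E E).flip W.subtypeL).continuous.tendsto _ |>.comp hR)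
    refine h1.congr fun t => ?_
    ext1 w
    change Wᗮ.orthogonalProjectionOnto ((t : ℂ)⁻¹ • (R t w - w)) =
      (t : ℂ)⁻¹ • Wᗮ.orthogonalProjectionOnto (R t w)
    rw [map_smul, map_sub, hW0, sub_zero]
  have hunit : ∀ᶠ t in 𝓝 (0 : ℝ), IsUnit (a t) :=
    hac.eventually (Units.nhds (R := W →L[ℂ] W) 1)
  have hinv : Tendsto (fun t => Ring.inverse (a t)) (𝓝 0) (𝓝 1) := by
    have h1 := (NormedRing.inverse_continuousAt (R := W →L[ℂ] W) 1).tendsto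
    rw [Units.val_one, Ring.inverse_one] at h1
    exact h1.comp hac
  have hbG : ∀ᶠ t in 𝓝 (0 : ℝ), ∀ w, b t w ∈ G := hG.mono fun t h w => h w w.2
  have hDG : ∀ w, D w ∈ G := fun w => hG' w w.2
  refine ⟨isHilbertSchmidt_of_mem G hDG, fun t => b t ∘L Ring.inverse (a t), ?_, ?_⟩
  · filter_upwards [hunit, hbG] with t h1 h2
    refine ⟨isHilbertSchmidt_of_mem G fun w => h2 _, ?_⟩
    have h4 : ∀ w, Ring.inverse (a t) (a t w) = w := fun w =>
      congrArg (fun f : W →L[ℂ] W => f w) (Ring.inverse_mul_cancel _ h1)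
    have h5 : ∀ w, a t (Ring.inverse (a t) w) = w := fun w =>
      congrArg (fun f : W →L[ℂ] W => f w) (Ring.mul_inverse_cancel _ h1)
    ext f
    constructor
    · rintro ⟨w, hw, rfl⟩
      refine ⟨a t ⟨w, hw⟩, ?_⟩
      change (a t ⟨w, hw⟩ : E) + (b t (Ring.inverse (a t) (a t ⟨w, hw⟩)) : Wᗮ) = R t w
      rw [h4]
      exact (hab t ⟨w, hw⟩).symm
    · rintro ⟨w, rfl⟩
      refine ⟨Ring.inverse (a t) w, (Ring.inverse (a t) w).2, ?_⟩
      change R t (Ring.inverse (a t) w : W) = (w : E) + (b t (Ring.inverse (a t) w) : Wᗮ)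
      rw [hab, h5]
  · have hlim : Tendsto (fun t : ℝ => (t : ℂ)⁻¹ • (b t ∘L Ring.inverse (a t)) - D)
        (𝓝[≠] 0) (𝓝 0) := by
      have h2 : Tendsto (fun t : ℝ => ((t : ℂ)⁻¹ • b t) ∘L Ring.inverse (a t)) (𝓝[≠] 0)
          (𝓝 (D ∘L 1)) :=
        ((isBoundedBilinearMap_comp (𝕜 := ℂ) (E := W) (F := W)
          (G := Wᗮ)).continuous.tendsto (D, 1)).comp
          (hbd.prodMk_nhds (hinv.mono_left nhdsWithin_le_nhds))
      have h3 := h2.sub_const D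
      have h4 : D ∘L (1 : W →L[ℂ] W) - D = 0 := sub_self _
      rw [h4] at h3
      exact h3
    have hb0' : b 0 ∘L Ring.inverse (a 0) = 0 := by rw [hb0, ContinuousLinearMap.zero_comp]
    simp only [hb0', sub_zero]
    refine tendsto_hsNormSq hlim G ?_
    exact (hbG.filter_mono nhdsWithin_le_nhds).mono fun (t : ℝ) ht w =>
      G.sub_mem (G.smul_mem _ (ht _)) (hDG w)

end Operators

/-! ### Subspaces between `z ^ n H₊` and `z ^ (-n) H₊` -/

section Grassmannian

variable {V : Type} [NormedAddCommGroup V] [InnerProductSpace ℂ V] [FiniteDimensional ℂ V]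
  [CompleteSpace V]

/-- Up to an element of `Hge b`, which `W` contains and the projection kills, `f` is its component
in the box. This supplies every finite-dimensional range used below. -/
theorem orthogonalProjectionOnto_mem_map_box {W : Submodule ℂ (LTwo V)} [CompleteSpace W] {a b : ℤ}
    (hW : Hge b ≤ W) {f : LTwo V} (hf : f ∈ Hge a) :
    Wᗮ.orthogonalProjectionOnto f ∈
      (box V a b).map Wᗮ.orthogonalProjectionOnto.toLinearMap := by
  refine ⟨(box V a b).starProjection f, (box V a b).starProjection_apply_mem f, ?_⟩
  have h := hW (sub_starProjection_box_mem_Hge b hf)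
  have h0 : Wᗮ.orthogonalProjectionOnto (f - (box V a b).starProjection f) = 0 :=
    Submodule.orthogonalProjectionOnto_eq_zero_iff.2 (Submodule.le_orthogonal_orthogonal _ h)
  rw [map_sub, sub_eq_zero] at h0
  exact h0.symm

/-- The projections `W → H₊` and `H₊ → W` are inverse to each other modulo finite rank, which is the
Fredholm property; `pr₋` on `W` has finite rank itself. -/
theorem mem_Gr_of_le {W : Submodule ℂ (LTwo V)} (hc : IsClosed (W : Set (LTwo V))) {n : ℤ}
    (h1 : Hge n ≤ W) (h2 : W ≤ Hge (-n)) : W ∈ Gr V := by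
  have : CompleteSpace W := hc.completeSpace_coe
  refine ⟨hc, ?_, ?_⟩
  · have hW : ∀ f : LTwo V, f = W.starProjection f + Wᗮ.starProjection f := fun f =>
      (W.starProjection_add_starProjection_orthogonal f).symm
    have hP : ∀ f : LTwo V, f = (hPlus V).starProjection f + (hPlus V)ᗮ.starProjection f := fun f =>
      ((hPlus V).starProjection_add_starProjection_orthogonal f).symm
    refine ContinuousLinearMap.IsFredholm.of_isQuasiInverse
      (v := W.orthogonalProjectionOnto ∘L (hPlus V).subtypeL) ⟨?_, ?_⟩
    · rw [LinearMap.IsLeftQuasiInverse, LinearMap.FiniteRangeSetoid.equiv_iff_hasFiniteRange,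
        LinearMap.hasFiniteRange_iff_range, Submodule.fg_iff_finiteDimensional]
      -- From `w = pr₊ w + pr₋ w` follows `pr_W pr₊ w - w = -pr_W pr₋ w`, and `pr₋ w` depends only
      -- on the modes of `w` in `[-n, 0)`.
      let S := ((box V (-n) 0).map (hPlus V)ᗮ.orthogonalProjectionOnto.toLinearMap).map
        (W.orthogonalProjectionOnto ∘L (hPlus V)ᗮ.subtypeL).toLinearMap
      refine Submodule.finiteDimensional_of_le (S₂ := S) ?_
      rintro _ ⟨w, rfl⟩
      rw [← S.neg_mem_iff]
      refine ⟨_, orthogonalProjectionOnto_mem_map_box hPlus_eq_Hge.ge (h2 w.2), ?_⟩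
      have hw : W.orthogonalProjectionOnto (w : LTwo V) = w :=
        W.orthogonalProjectionOnto_mem_subspace_eq_self w
      have := congrArg W.orthogonalProjectionOnto (hP w)
      rw [map_add, hw] at this
      change W.orthogonalProjectionOnto ((hPlus V)ᗮ.starProjection (w : LTwo V)) =
        -(W.orthogonalProjectionOnto ((hPlus V).starProjection (w : LTwo V)) - w)
      rw [neg_sub]
      exact eq_sub_of_add_eq' this.symm
    · rw [LinearMap.IsRightQuasiInverse, LinearMap.FiniteRangeSetoid.equiv_iff_hasFiniteRange,
        LinearMap.hasFiniteRange_iff_range, Submodule.fg_iff_finiteDimensional]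
      let S := ((box V 0 n).map Wᗮ.orthogonalProjectionOnto.toLinearMap).map
        ((hPlus V).orthogonalProjectionOnto ∘L Wᗮ.subtypeL).toLinearMap
      refine Submodule.finiteDimensional_of_le (S₂ := S) ?_
      rintro _ ⟨w, rfl⟩
      rw [← S.neg_mem_iff]
      refine ⟨_, orthogonalProjectionOnto_mem_map_box h1 (hPlus_eq_Hge.le w.2), ?_⟩
      have hw : (hPlus V).orthogonalProjectionOnto (w : LTwo V) = w :=
        (hPlus V).orthogonalProjectionOnto_mem_subspace_eq_self w
      have := congrArg (hPlus V).orthogonalProjectionOnto (hW w)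
      rw [map_add, hw] at this
      change (hPlus V).orthogonalProjectionOnto (Wᗮ.starProjection (w : LTwo V)) =
        -((hPlus V).orthogonalProjectionOnto (W.starProjection (w : LTwo V)) - w)
      rw [neg_sub]
      exact eq_sub_of_add_eq' this.symm
  · exact isHilbertSchmidt_of_mem _ fun w =>
      orthogonalProjectionOnto_mem_map_box hPlus_eq_Hge.ge (h2 w.2)

theorem mem_GrZero_of_le {W : Submodule ℂ (LTwo V)} (hc : IsClosed (W : Set (LTwo V))) {n : ℕ}
    (h1 : Hge n ≤ W) (h2 : W ≤ Hge (-n)) : W ∈ GrZero V := by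
  refine Set.mem_iUnion.2 ⟨n, mem_Gr_of_le hc h1 h2, ?_, ?_⟩
  · rwa [zPowMul_hPlus]
  · rwa [zPowMul_hPlus]

/-- A curve `t ↦ R t W`, with `R` differentiable in operator norm, whose chart coordinates at `W`
have range in a fixed finite-dimensional space, has velocity `pr_{Wᗮ} R'(0)`. -/
theorem hasGrVelocity_of_tendsto_slope {W : Submodule ℂ (LTwo V)} [CompleteSpace W]
    {U : ℝ → Submodule ℂ (LTwo V)} {R : ℝ → LTwo V →L[ℂ] LTwo V} {R' : LTwo V →L[ℂ] LTwo V}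
    (hR : Tendsto (fun t : ℝ => (t : ℂ)⁻¹ • (R t - 1)) (𝓝[≠] 0) (𝓝 R')) (hR0 : R 0 = 1)
    (hU0 : U 0 = W) (hU : ∀ᶠ t in 𝓝 (0 : ℝ), U t = W.map (R t).toLinearMap)
    (G : Submodule ℂ Wᗮ) [FiniteDimensional ℂ G]
    (hG : ∀ᶠ t in 𝓝 (0 : ℝ), ∀ w ∈ W, Wᗮ.orthogonalProjectionOnto (R t w) ∈ G)
    (hG' : ∀ w ∈ W, Wᗮ.orthogonalProjectionOnto (R' w) ∈ G) :
    HasGrVelocity U W (Wᗮ.orthogonalProjectionOnto ∘L R' ∘L W.subtypeL) := by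
  obtain ⟨h1, T, h2, h3⟩ := exists_chart_of_tendsto_slope hR hR0 G hG hG'
  refine ⟨hU0, h1, T, ?_, h3⟩
  filter_upwards [h2, hU] with t ht ht'
  exact ⟨ht.1, ht'.trans ht.2⟩

end Grassmannian

/-! ### Laurent polynomials with values in a vector space, and their discrete Fourier coefficients
-/

section Laurent

variable {E E' : Type} [AddCommGroup E] [Module ℂ E] [AddCommGroup E'] [Module ℂ E']

/-- `F` is an `E`-valued Laurent polynomial of degree at most `n` on the circle. -/
def IsLaurentPoly (n : ℕ) (F : Circ → E) : Prop :=
  ∃ A : ℤ → E, ∀ θ, F θ = ∑ k ∈ Finset.Icc (-(n : ℤ)) n, fourier k θ • A k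

theorem isLaurentPoly_monomial {n : ℕ} {k : ℤ} (hk : k ∈ Finset.Icc (-(n : ℤ)) n) (a : E) :
    IsLaurentPoly n fun θ => fourier k θ • a := by
  refine ⟨Pi.single k a, fun θ => ?_⟩
  rw [Finset.sum_eq_single k]
  · rw [Pi.single_eq_same]
  · intro l _ hl
    rw [Pi.single_eq_of_ne hl, smul_zero]
  · exact fun h => absurd hk h

theorem IsLaurentPoly.add {n : ℕ} {F G : Circ → E} (hF : IsLaurentPoly n F)
    (hG : IsLaurentPoly n G) : IsLaurentPoly n fun θ => F θ + G θ := by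
  obtain ⟨A, hA⟩ := hF
  obtain ⟨B, hB⟩ := hG
  refine ⟨fun k => A k + B k, fun θ => ?_⟩
  simp only [smul_add, Finset.sum_add_distrib, ← hA, ← hB]

theorem IsLaurentPoly.sum {ι : Type} {s : Finset ι} {n : ℕ} {F : ι → Circ → E}
    (h : ∀ i ∈ s, IsLaurentPoly n (F i)) : IsLaurentPoly n fun θ => ∑ i ∈ s, F i θ := by
  classical
  induction s using Finset.induction_on with
  | empty => exact ⟨0, fun θ => by simp⟩
  | insert i s hi ih =>
    simp only [Finset.sum_insert hi]
    exact (h i (Finset.mem_insert_self _ _)).add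
      (ih fun j hj => h j (Finset.mem_insert_of_mem hj))

theorem IsLaurentPoly.map {n : ℕ} {F : Circ → E} (hF : IsLaurentPoly n F) (f : E →ₗ[ℂ] E') :
    IsLaurentPoly n fun θ => f (F θ) := by
  obtain ⟨A, hA⟩ := hF
  exact ⟨fun k => f (A k), fun θ => by simp only [hA, map_sum, map_smul]⟩

theorem IsLaurentPoly.mono {m n : ℕ} (h : m ≤ n) {F : Circ → E} (hF : IsLaurentPoly m F) :
    IsLaurentPoly n F := by
  obtain ⟨A, hA⟩ := hF
  rw [funext hA]
  refine IsLaurentPoly.sum fun k hk => isLaurentPoly_monomial ?_ _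
  rw [Finset.mem_Icc] at hk ⊢
  omega

theorem IsLaurentPoly.bilin {E'' : Type} [AddCommGroup E''] [Module ℂ E''] {m n : ℕ}
    {F : Circ → E} {G : Circ → E'} (hF : IsLaurentPoly m F) (hG : IsLaurentPoly n G)
    (B : E →ₗ[ℂ] E' →ₗ[ℂ] E'') : IsLaurentPoly (m + n) fun θ => B (F θ) (G θ) := by
  obtain ⟨A, hA⟩ := hF
  obtain ⟨A', hA'⟩ := hG
  have : ∀ θ, B (F θ) (G θ) = ∑ k ∈ Finset.Icc (-(m : ℤ)) m, ∑ l ∈ Finset.Icc (-(n : ℤ)) n,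
      fourier (k + l) θ • B (A k) (A' l) := by
    intro θ
    rw [hA, hA', map_sum B, LinearMap.sum_apply]
    refine Finset.sum_congr rfl fun k _ => ?_
    rw [map_sum]
    refine Finset.sum_congr rfl fun l _ => ?_
    rw [map_smul, map_smul, LinearMap.smul_apply, smul_smul, fourier_add, mul_comm]
  rw [funext this]
  refine IsLaurentPoly.sum fun k hk => IsLaurentPoly.sum fun l hl => isLaurentPoly_monomial ?_ _
  rw [Finset.mem_Icc] at *
  omega

/-- The discrete Fourier coefficient of `F` at `2 n + 1` equidistant points. -/
def dftCoeff (n : ℕ) (F : Circ → E) (k : ℤ) : E :=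
  (2 * n + 1 : ℂ)⁻¹ • ∑ j ∈ Finset.range (2 * n + 1),
    fourier (-k) ((2 * π * j / (2 * n + 1) : ℝ) : Circ) •
      F ((2 * π * j / (2 * n + 1) : ℝ) : Circ)

/-- A geometric series in a `(2n + 1)`-th root of unity, whose ratio is `1` only if `2n + 1` divides
`m`; the bound on `m` then forces `m = 0`. -/
theorem sum_fourier_roots (n : ℕ) {m : ℤ} (hm : |m| ≤ 2 * n) :
    ∑ j ∈ Finset.range (2 * n + 1), fourier m ((2 * π * j / (2 * n + 1) : ℝ) : Circ) =
      if m = 0 then (2 * n + 1 : ℂ) else 0 := by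
  have hn : (2 * n + 1 : ℂ) ≠ 0 := by exact_mod_cast (2 * n).succ_ne_zero
  let ζ : ℂ := Complex.exp (2 * π * Complex.I * (m / (2 * n + 1)))
  have h1 : ∀ j : ℕ, fourier m ((2 * π * j / (2 * n + 1) : ℝ) : Circ) = ζ ^ j := by
    intro j
    rw [fourier_coe_apply, ← Complex.exp_nat_mul]
    congr 1
    have hπ : (π : ℂ) ≠ 0 := by exact_mod_cast Real.pi_ne_zero
    push_cast
    field_simp
  simp only [h1]
  split_ifs with h
  · have : ζ = 1 := by simp [ζ, h]
    simp [this]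
  · have hζ : ζ ≠ 1 := by
      intro hζ
      obtain ⟨q, hq⟩ := Complex.exp_eq_one_iff.1 hζ
      have h2 : (m : ℂ) / (2 * n + 1) = q := by
        have hI : (2 * π * Complex.I : ℂ) ≠ 0 := Complex.two_pi_I_ne_zero
        rw [mul_comm] at hq
        exact mul_right_cancel₀ hI hq
      rw [div_eq_iff hn] at h2
      have h3 : m = q * (2 * n + 1) := by exact_mod_cast h2
      have hq0 : q ≠ 0 := by rintro rfl; exact h (by simpa using h3)
      have h4 : 1 ≤ |q| := Int.one_le_abs hq0
      have h5 : |m| = |q| * (2 * n + 1) := by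
        rw [h3, abs_mul, abs_of_nonneg (by positivity : (0 : ℤ) ≤ 2 * n + 1)]
      nlinarith
    rw [geom_sum_eq hζ]
    have : ζ ^ (2 * n + 1) = 1 := by
      rw [← Complex.exp_nat_mul, Complex.exp_eq_one_iff]
      refine ⟨m, ?_⟩
      push_cast
      field_simp
    rw [this, sub_self, zero_div]

/-- Differences of two frequencies in `[-n, n]` have size at most `2n`, so `2n + 1` sample points
separate them. Coefficients thus are unique and depend linearly on finitely many values, without any
topology on `E`. -/
theorem dftCoeff_eq {n : ℕ} {F : Circ → E} {A : ℤ → E}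
    (h : ∀ θ, F θ = ∑ k ∈ Finset.Icc (-(n : ℤ)) n, fourier k θ • A k) {k : ℤ}
    (hk : k ∈ Finset.Icc (-(n : ℤ)) n) : dftCoeff n F k = A k := by
  have hn : (2 * n + 1 : ℂ) ≠ 0 := by exact_mod_cast (2 * n).succ_ne_zero
  rw [dftCoeff, inv_smul_eq_iff₀ hn]
  simp only [h, Finset.smul_sum, smul_smul, ← fourier_add]
  rw [Finset.sum_comm]
  simp only [← Finset.sum_smul]
  rw [Finset.sum_eq_single k]
  · rw [sum_fourier_roots n (by simp), if_pos (by ring)]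
  · intro l hl hlk
    rw [Finset.mem_Icc] at hk hl
    rw [sum_fourier_roots n (abs_le.2 ⟨by omega, by omega⟩), if_neg (by omega), zero_smul]
  · exact fun h' => absurd hk h'

theorem IsLaurentPoly.eq_sum_dftCoeff {n : ℕ} {F : Circ → E} (hF : IsLaurentPoly n F) (θ : Circ) :
    F θ = ∑ k ∈ Finset.Icc (-(n : ℤ)) n, fourier k θ • dftCoeff n F k := by
  obtain ⟨A, hA⟩ := hF
  rw [hA θ]
  exact Finset.sum_congr rfl fun k hk => by rw [dftCoeff_eq hA hk]

theorem map_dftCoeff (f : E →ₗ[ℂ] E') (n : ℕ) (F : Circ → E) (k : ℤ) :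
    f (dftCoeff n F k) = dftCoeff n (fun θ => f (F θ)) k := by
  simp only [dftCoeff, map_smul, map_sum]

/-- The coefficients are combinations of values of `F`, so they already lie in `E`; the expansion
may be checked after applying `f`. -/
theorem IsLaurentPoly.of_injective {n : ℕ} {F : Circ → E} {f : E →ₗ[ℂ] E'}
    (hf : Function.Injective f) (h : IsLaurentPoly n fun θ => f (F θ)) : IsLaurentPoly n F := by
  refine ⟨dftCoeff n F, fun θ => hf ?_⟩
  rw [map_sum]
  simp only [map_smul, map_dftCoeff]
  exact h.eq_sum_dftCoeff θ

end Laurent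

/-! ### From pointwise to uniform differentiability -/

section Interpolation

variable {E : Type} [NormedAddCommGroup E] [NormedSpace ℂ E]

theorem tendsto_slope_dftCoeff {n : ℕ} {F : ℝ → Circ → E} {F' : Circ → E}
    (h : ∀ θ, Tendsto (fun t : ℝ => (t : ℂ)⁻¹ • (F t θ - F 0 θ)) (𝓝[≠] 0) (𝓝 (F' θ))) (k : ℤ) :
    Tendsto (fun t : ℝ => (t : ℂ)⁻¹ • (dftCoeff n (F t) k - dftCoeff n (F 0) k)) (𝓝[≠] 0)
      (𝓝 (dftCoeff n F' k)) := by
  have h1 := (tendsto_finsetSum (Finset.range (2 * n + 1)) fun j _ =>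
    (h ((2 * π * j / (2 * n + 1) : ℝ) : Circ)).const_smul
      (fourier (-k) ((2 * π * j / (2 * n + 1) : ℝ) : Circ))).const_smul ((2 * n + 1 : ℂ)⁻¹)
  refine h1.congr fun t => ?_
  simp only [dftCoeff, ← smul_sub, ← Finset.sum_sub_distrib]
  rw [smul_comm]
  congr 1
  rw [Finset.smul_sum]
  exact Finset.sum_congr rfl fun j _ => smul_comm _ _ _

/-- The Laurent polynomial of degree `n` that interpolates `F`. -/
def interp (n : ℕ) (F : Circ → E) : C(Circ, E) := lpoly n (dftCoeff n F)

theorem interp_apply {n : ℕ} {F : Circ → E} (hF : IsLaurentPoly n F) (θ : Circ) :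
    interp n F θ = F θ := by
  rw [interp, lpoly_apply, ← hF.eq_sum_dftCoeff]

/-- The interpolant depends linearly and continuously on `2n + 1` values, so pointwise limits of
slopes become limits in the supremum norm. -/
theorem tendsto_slope_interp {n : ℕ} {F : ℝ → Circ → E} {F' : Circ → E}
    (h : ∀ θ, Tendsto (fun t : ℝ => (t : ℂ)⁻¹ • (F t θ - F 0 θ)) (𝓝[≠] 0) (𝓝 (F' θ))) :
    Tendsto (fun t : ℝ => (t : ℂ)⁻¹ • (interp n (F t) - interp n (F 0))) (𝓝[≠] 0)
      (𝓝 (interp n F')) := by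
  have h1 : Tendsto (fun t : ℝ => ∑ k ∈ Finset.Icc (-(n : ℤ)) n,
      trig k ((t : ℂ)⁻¹ • (dftCoeff n (F t) k - dftCoeff n (F 0) k))) (𝓝[≠] 0)
      (𝓝 (∑ k ∈ Finset.Icc (-(n : ℤ)) n, trig k (dftCoeff n F' k))) :=
    tendsto_finsetSum _ fun k _ =>
      ((trig k).continuous.tendsto _).comp (tendsto_slope_dftCoeff h k)
  refine h1.congr fun t => ?_
  simp only [interp, lpoly, map_smul, map_sub, ← Finset.smul_sum, Finset.sum_sub_distrib]

end Interpolation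

/-- Evaluation on a basis is an injective linear map between finite-dimensional spaces, hence a
topological embedding. -/
theorem tendsto_clm_of_pointwise {α V F : Type} [NormedAddCommGroup V] [NormedSpace ℂ V]
    [FiniteDimensional ℂ V] [NormedAddCommGroup F] [NormedSpace ℂ F] [FiniteDimensional ℂ F]
    {l : Filter α} {T : α → V →L[ℂ] F} {T' : V →L[ℂ] F}
    (h : ∀ v, Tendsto (fun t => T t v) l (𝓝 (T' v))) : Tendsto T l (𝓝 T') := by
  let b := Module.finBasis ℂ V
  let ev : (V →L[ℂ] F) →ₗ[ℂ] (Fin (Module.finrank ℂ V) → F) :=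
    { toFun := fun T i => T (b i)
      map_add' := fun _ _ => rfl
      map_smul' := fun _ _ => rfl }
  have hev : Function.Injective ev := fun S S' hS =>
    ContinuousLinearMap.coe_injective (b.ext fun i => congrFun hS i)
  rw [(LinearMap.isClosedEmbedding_of_injective (LinearMap.ker_eq_bot.2 hev)).isInducing.tendsto_nhds_iff,
    tendsto_pi_nhds]
  exact fun i => h (b i)

/-! ### The complexified Lie algebra and the adjoint action -/

section Lie

variable {N : ℕ} {K : Subgroup (UN N)}

/-- The inclusion of `𝔨_ℂ` in the matrices, as a linear map. -/
def KC.valLin (K : Subgroup (UN N)) : KC K →ₗ[ℂ] Mat N where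
  toFun := KC.val
  map_add' := KC.val_add
  map_smul' := KC.val_smul

theorem KC.val_ofReal (X : lieAlg K) : (KC.ofReal X).val = X := rfl

/-- The inclusion of `𝔨` in `𝔨_ℂ`, as a real linear map. -/
def KC.ofRealLin (K : Subgroup (UN N)) : lieAlg K →ₗ[ℝ] KC K where
  toFun := KC.ofReal
  map_add' _ _ := rfl
  map_smul' _ _ := rfl

theorem KC.ofReal_injective : Function.Injective (KC.ofReal (K := K)) := fun _ _ h =>
  Subtype.ext (congrArg KC.val h)

theorem KC.exists_eq (A : KC K) :
    ∃ X Y : lieAlg K, A = KC.ofReal X + Complex.I • KC.ofReal Y := by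
  obtain ⟨X, hX, Y, hY, h⟩ := A.2
  exact ⟨⟨X, hX⟩, ⟨Y, hY⟩, KC.val_injective h⟩

theorem KC.conjT_conjT (A : KC K) : A.conjT.conjT = A :=
  KC.val_injective (by simp only [KC.val_conjT, star_star])

theorem KC.conjT_ofReal (X : lieAlg K) : (KC.ofReal X).conjT = -KC.ofReal X :=
  KC.val_injective (star_of_mem_lieAlg K X.2)

/-- Elements of `𝔨` are skew-Hermitian, so taking adjoints turns `X + iY = 0` into `X - iY = 0`. -/
theorem KC.ofReal_eq_zero_of_add_I_smul {X Y : lieAlg K}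
    (h : KC.ofReal X + Complex.I • KC.ofReal Y = 0) : X = 0 ∧ Y = 0 := by
  have h1 : KC.ofReal X - Complex.I • KC.ofReal Y = 0 := by
    have h2 := congrArg KC.conjT h
    rw [KC.conjT_add, KC.conjT_smul, KC.conjT_ofReal, KC.conjT_ofReal, Complex.conj_I] at h2
    have h3 : (0 : KC K).conjT = 0 := KC.val_injective (star_zero _)
    rw [h3, neg_smul, smul_neg, neg_neg] at h2
    rw [← neg_eq_zero, ← h2]
    abel
  have h2 : (2 : ℂ) • KC.ofReal X = 0 := by
    rw [two_smul]
    calc KC.ofReal X + KC.ofReal X = (KC.ofReal X + Complex.I • KC.ofReal Y) +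
          (KC.ofReal X - Complex.I • KC.ofReal Y) := by abel
      _ = 0 := by rw [h, h1, add_zero]
  have hX := (smul_eq_zero.1 h2).resolve_left two_ne_zero
  rw [hX, zero_add] at h
  have hY := (smul_eq_zero.1 h).resolve_left Complex.I_ne_zero
  exact ⟨KC.ofReal_injective hX, KC.ofReal_injective hY⟩

theorem KC.coe_smul_ofReal (r : ℝ) (X : lieAlg K) :
    (r : ℂ) • KC.ofReal X = KC.ofReal (r • X) :=
  KC.val_injective (Complex.coe_smul r (X : Mat N))

theorem KC.ofReal_sum {ι : Type} (s : Finset ι) (f : ι → lieAlg K) :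
    KC.ofReal (∑ i ∈ s, f i) = ∑ i ∈ s, KC.ofReal (f i) := by
  have h := map_sum (KC.ofRealLin K) f s
  exact h

/-- A real basis of `𝔨` is a complex basis of `𝔨_ℂ`. -/
def KC.basis {ι : Type} [Fintype ι] (b : Module.Basis ι ℝ (lieAlg K)) :
    Module.Basis ι ℂ (KC K) :=
  Module.Basis.mk (v := fun i => KC.ofReal (b i))
    (by
      rw [Fintype.linearIndependent_iff]
      intro z hz i
      have h1 : ∑ i, z i • KC.ofReal (b i) =
          KC.ofReal (∑ i, (z i).re • b i) + Complex.I • KC.ofReal (∑ i, (z i).im • b i) := by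
        rw [KC.ofReal_sum, KC.ofReal_sum, Finset.smul_sum, ← Finset.sum_add_distrib]
        refine Finset.sum_congr rfl fun i _ => ?_
        rw [← KC.coe_smul_ofReal, ← KC.coe_smul_ofReal, smul_smul, ← add_smul,
          mul_comm Complex.I, Complex.re_add_im]
      rw [h1] at hz
      obtain ⟨h2, h3⟩ := KC.ofReal_eq_zero_of_add_I_smul hz
      have hb := Fintype.linearIndependent_iff.1 b.linearIndependent
      exact Complex.ext (hb _ h2 i) (hb _ h3 i))
    (by
      have hmem : ∀ X : lieAlg K, KC.ofReal X ∈
          Submodule.span ℂ (Set.range fun i => KC.ofReal (b i)) := by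
        intro X
        rw [← b.sum_repr X, KC.ofReal_sum]
        refine Submodule.sum_mem _ fun i _ => ?_
        rw [← KC.coe_smul_ofReal]
        exact Submodule.smul_mem _ _ (Submodule.subset_span ⟨i, rfl⟩)
      intro A _
      obtain ⟨X, Y, rfl⟩ := A.exists_eq
      exact Submodule.add_mem _ (hmem X) (Submodule.smul_mem _ _ (hmem Y)))

theorem KC.basis_apply {ι : Type} [Fintype ι] (b : Module.Basis ι ℝ (lieAlg K)) (i : ι) :
    KC.basis b i = KC.ofReal (b i) := Module.Basis.mk_apply _ _ i

theorem KC.basis_repr_ofReal {ι : Type} [Fintype ι] (b : Module.Basis ι ℝ (lieAlg K))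
    (X : lieAlg K) (i : ι) : (KC.basis b).repr (KC.ofReal X) i = (b.repr X i : ℂ) := by
  classical
  conv_lhs => rw [← b.sum_repr X, KC.ofReal_sum]
  simp only [← KC.coe_smul_ofReal, ← KC.basis_apply, map_sum, map_smul, Module.Basis.repr_self,
    Finsupp.coe_finsetSum, Finset.sum_apply, Finsupp.smul_apply, Finsupp.single_apply]
  simp

/-- In a real basis of `𝔨`, used also as a complex basis of `𝔨_ℂ`, both traces are those of the same
real matrix. -/
theorem killingForm_ofReal (X Y : lieAlg K) :
    killingForm ℂ (KC K) (KC.ofReal X) (KC.ofReal Y) = (killingForm ℝ (lieAlg K) X Y : ℂ) := by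
  classical
  let b := Module.finBasis ℝ (lieAlg K)
  rw [killingForm_apply_apply, killingForm_apply_apply,
    LinearMap.trace_eq_matrix_trace ℝ b, LinearMap.trace_eq_matrix_trace ℂ (KC.basis b),
    Matrix.trace, Matrix.trace, Complex.ofReal_sum]
  refine Finset.sum_congr rfl fun i _ => ?_
  rw [Matrix.diag_apply, Matrix.diag_apply, LinearMap.toMatrix_apply, LinearMap.toMatrix_apply,
    KC.basis_apply]
  exact KC.basis_repr_ofReal b ⁅X, ⁅Y, b i⁆⁆ i

theorem conj_mem_lieAlgC {k : UN N} (hk : k ∈ K) {A : Mat N} (hA : A ∈ lieAlgC K) :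
    (k : Mat N) * A * star (k : Mat N) ∈ lieAlgC K := by
  obtain ⟨X, hX, Y, hY, rfl⟩ := hA
  refine ⟨_, conj_mem_tangentOne K hk hX, _, conj_mem_tangentOne K hk hY, ?_⟩
  rw [mul_add, add_mul, mul_smul_comm, smul_mul_assoc]

/-- A retraction makes conjugation by any unitary matrix an endomorphism of `𝔨_ℂ`, with no
membership proof in the definition; for `k ∈ K` the choice is immaterial. It also carries limits of
matrices back to `𝔨_ℂ`. -/
theorem exists_retract (K : Subgroup (UN N)) :
    ∃ r : Mat N →ₗ[ℂ] KC K, r ∘ₗ KC.valLin K = LinearMap.id :=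
  LinearMap.exists_leftInverse_of_injective _ (LinearMap.ker_eq_bot.2 KC.val_injective)

/-- A linear projection of the matrices onto `𝔨_ℂ`. -/
def retract (K : Subgroup (UN N)) : Mat N →ₗ[ℂ] KC K := (exists_retract K).choose

theorem retract_val (A : KC K) : retract K A.val = A :=
  LinearMap.congr_fun (exists_retract K).choose_spec A

theorem val_retract {A : Mat N} (hA : A ∈ lieAlgC K) : (retract K A).val = A :=
  congrArg KC.val (retract_val (⟨A, hA⟩ : ↥(lieAlgC K)))

/-- The adjoint action of `K` on `𝔨_ℂ`, as a linear map. -/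
def adLin (K : Subgroup (UN N)) (k : UN N) : KC K →ₗ[ℂ] KC K :=
  retract K ∘ₗ LinearMap.mulRight ℂ (star (k : Mat N)) ∘ₗ LinearMap.mulLeft ℂ (k : Mat N) ∘ₗ
    KC.valLin K

theorem adLin_apply (k : UN N) (A : KC K) :
    adLin K k A = retract K ((k : Mat N) * A.val * star (k : Mat N)) := rfl

theorem val_adLin {k : UN N} (hk : k ∈ K) (A : KC K) :
    (adLin K k A).val = (k : Mat N) * A.val * star (k : Mat N) :=
  val_retract (conj_mem_lieAlgC hk A.2)

theorem adLin_one (A : KC K) : adLin K 1 A = A := by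
  rw [adLin_apply]
  simp [retract_val]

theorem adLin_mul {k l : UN N} (hl : l ∈ K) (A : KC K) :
    adLin K (k * l) A = adLin K k (adLin K l A) := by
  rw [adLin_apply, adLin_apply, val_adLin hl]
  congr 1
  rw [Submonoid.coe_mul, star_mul]
  simp only [mul_assoc]

theorem adLin_lie {k : UN N} (hk : k ∈ K) (A B : KC K) :
    adLin K k ⁅A, B⁆ = ⁅adLin K k A, adLin K k B⁆ := by
  apply KC.val_injective
  have h : star (k : Mat N) * (k : Mat N) = 1 := Unitary.coe_star_mul_self k
  have h2 : ∀ P Q : Mat N, (k : Mat N) * P * star (k : Mat N) * ((k : Mat N) * Q * star (k : Mat N)) =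
      (k : Mat N) * (P * Q) * star (k : Mat N) := by
    intro P Q
    calc _ = (k : Mat N) * P * (star (k : Mat N) * (k : Mat N)) * Q * star (k : Mat N) := by
          simp only [mul_assoc]
      _ = _ := by rw [h]; simp only [mul_assoc, one_mul]
  rw [val_adLin hk, KC.val_lie, KC.val_lie, val_adLin hk, val_adLin hk, h2, h2, mul_sub, sub_mul]

/-- The adjoint action of an element of `K` as an automorphism of the Lie algebra `𝔨_ℂ`. -/
def adEquiv {k : UN N} (hk : k ∈ K) : KC K ≃ₗ⁅ℂ⁆ KC K where
  toFun := adLin K k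
  map_add' := map_add _
  map_smul' := map_smul _
  map_lie' := adLin_lie hk _ _
  invFun := adLin K k⁻¹
  left_inv A := by
    rw [← adLin_mul hk, inv_mul_cancel, adLin_one]
  right_inv A := by
    rw [← adLin_mul (K.inv_mem hk), mul_inv_cancel, adLin_one]

theorem conjT_adLin {k : UN N} (hk : k ∈ K) (A : KC K) :
    (adLin K k A).conjT = adLin K k A.conjT := by
  apply KC.val_injective
  rw [KC.val_conjT, val_adLin hk, val_adLin hk, KC.val_conjT, star_mul, star_mul, star_star,
    mul_assoc]

theorem KC.conjT_lie (A B : KC K) : (⁅A, B⁆ : KC K).conjT = ⁅B.conjT, A.conjT⁆ := by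
  apply KC.val_injective
  rw [KC.val_conjT, KC.val_lie, KC.val_lie, star_sub, star_mul, star_mul]
  rfl

end Lie

/-! ### Invariance of the Killing inner product -/

section Killing

variable {N : ℕ} {K : Subgroup (UN N)} [LieAlgebra.IsKilling ℝ (lieAlg K)]

theorem KC.inner_def (A B : KC K) : ⟪A, B⟫_ℂ = killingForm ℂ (KC K) A.conjT B := rfl

/-- The adjoint action of `K` on `𝔨_ℂ`, as a continuous linear map. -/
def adK (K : Subgroup (UN N)) [LieAlgebra.IsKilling ℝ (lieAlg K)] (k : UN N) : KC K →L[ℂ] KC K :=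
  LinearMap.toContinuousLinearMap (adLin K k)

theorem adK_apply (k : UN N) (A : KC K) : adK K k A = adLin K k A := rfl

/-- `Ad_k` commutes with `A ↦ A*` because `k` is unitary, and the Killing form is invariant under
Lie algebra automorphisms. -/
theorem inner_adLin {k : UN N} (hk : k ∈ K) (A B : KC K) :
    ⟪adLin K k A, adLin K k B⟫_ℂ = ⟪A, B⟫_ℂ := by
  rw [KC.inner_def, conjT_adLin hk, KC.inner_def]
  exact LieAlgebra.killingForm_of_equiv_apply (adEquiv hk) _ _

/-- The bracket of `𝔨_ℂ` as a continuous linear map. -/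
def adC (K : Subgroup (UN N)) [LieAlgebra.IsKilling ℝ (lieAlg K)] : KC K →ₗ[ℂ] KC K →L[ℂ] KC K where
  toFun A := LinearMap.toContinuousLinearMap (LieAlgebra.ad ℂ (KC K) A)
  map_add' A B := ContinuousLinearMap.ext fun C => add_lie A B C
  map_smul' z A := ContinuousLinearMap.ext fun C => smul_lie z A C

theorem adC_apply (A B : KC K) : adC K A B = ⁅A, B⁆ := rfl

theorem inner_lie_left (A C D : KC K) : ⟪⁅A, C⁆, D⟫_ℂ = ⟪C, ⁅A.conjT, D⁆⟫_ℂ := by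
  rw [KC.inner_def, KC.inner_def, KC.conjT_lie]
  exact LieModule.traceForm_apply_lie_apply ℂ (KC K) (KC K) _ _ _

/-- Invariance of the Killing form gives `ad(A)* = ad(A*)`, after which the trace is `κ(A*, B)` by
definition. -/
theorem traceAd_eq_inner (A B : KC K) : traceAd K A B = ⟪A, B⟫_ℂ := by
  have h : LinearMap.adjoint (LieAlgebra.ad ℂ (KC K) A : KC K →ₗ[ℂ] KC K) =
      LieAlgebra.ad ℂ (KC K) A.conjT := by
    symm
    rw [LinearMap.eq_adjoint_iff]
    intro C D
    rw [LieAlgebra.ad_apply, LieAlgebra.ad_apply, inner_lie_left, KC.conjT_conjT]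
  rw [traceAd, h, KC.inner_def, killingForm_apply_apply]

theorem sum_inner_lie {ι : Type} [Fintype ι] (b : OrthonormalBasis ι ℂ (KC K)) (A B : KC K) :
    ∑ i, ⟪⁅A, b i⁆, ⁅B, b i⁆⟫_ℂ = ⟪A, B⟫_ℂ := by
  rw [← traceAd_eq_inner, traceAd, LinearMap.trace_eq_sum_inner _ b]
  refine Finset.sum_congr rfl fun i _ => ?_
  rw [LinearMap.comp_apply, LinearMap.adjoint_inner_right]
  rfl

theorem inner_ofReal (X Y : lieAlg K) :
    ⟪KC.ofReal X, KC.ofReal Y⟫_ℂ = ((-killingForm ℝ (lieAlg K) X Y : ℝ) : ℂ) := by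
  rw [KC.inner_def, KC.conjT_ofReal, map_neg, LinearMap.neg_apply, killingForm_ofReal,
    Complex.ofReal_neg]

theorem inner_conjT (A B : KC K) : ⟪A.conjT, B.conjT⟫_ℂ = ⟪B, A⟫_ℂ := by
  rw [KC.inner_def, KC.inner_def, KC.conjT_conjT]
  exact LieModule.traceForm_comm ℂ (KC K) (KC K) _ _

/-- Product rule for `c A c*`: the last factor contributes `X* = -X`, and the commutator appears. -/
theorem tendsto_slope_adK {c : ℝ → UN N} {X : lieAlg K}
    (hc : HasDerivAt (fun t => (c t : Mat N)) ((c 0 : Mat N) * (X : Mat N)) 0) :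
    Tendsto (fun t : ℝ => (t : ℂ)⁻¹ • (adK K (c t) - adK K (c 0))) (𝓝[≠] 0)
      (𝓝 (adK K (c 0) ∘L adC K (KC.ofReal X))) := by
  refine tendsto_clm_of_pointwise fun A => ?_
  have hconst : HasDerivAt (fun _ : ℝ => A.val) 0 0 := by
    rw [hasDerivAt_mat]; intro i j; exact hasDerivAt_const _ _
  have h := hasDerivAt_mul (hasDerivAt_mul hc hconst) (hasDerivAt_star hc)
  have h1 : Tendsto (fun t : ℝ => t⁻¹ • ((c t : Mat N) * A.val * star (c t : Mat N) -
      (c 0 : Mat N) * A.val * star (c 0 : Mat N))) (𝓝[≠] 0)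
      (𝓝 ((c 0 : Mat N) * (⁅KC.ofReal X, A⁆ : KC K).val * star (c 0 : Mat N))) := by
    let _ : NormedAddCommGroup (Mat N) := Matrix.normedAddCommGroup
    let _ : NormedSpace ℝ (Mat N) := Matrix.normedSpace
    have h2 := hasDerivAt_iff_tendsto_slope_zero.1 h
    simp only [zero_add] at h2
    have h3 : (c 0 : Mat N) * (⁅KC.ofReal X, A⁆ : KC K).val * star (c 0 : Mat N) =
        ((c 0 : Mat N) * X * A.val + (c 0 : Mat N) * 0) * star (c 0 : Mat N) +
          (c 0 : Mat N) * A.val * star ((c 0 : Mat N) * X) := by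
      rw [KC.val_lie, KC.val_ofReal, star_mul, star_of_mem_lieAlg K X.2]
      noncomm_ring
    rw [h3]
    exact h2
  have hr : Continuous (retract K) := LinearMap.continuous_of_finiteDimensional _
  refine ((hr.tendsto _).comp h1).congr fun t => ?_
  rw [Function.comp_apply, ← Complex.coe_smul, Complex.ofReal_inv, map_smul, map_sub]
  rfl

end Killing

/-! ### The algebraic loop group, and loops that centralize `𝔨` -/

section LoopGroup

variable {N : ℕ} {K : Subgroup (UN N)}

theorem isLaurentPoly_star {m : ℕ} {F : Circ → Mat N} (hF : IsLaurentPoly m F) :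
    IsLaurentPoly m fun θ => star (F θ) := by
  obtain ⟨A, hA⟩ := hF
  have : ∀ θ, star (F θ) = ∑ k ∈ Finset.Icc (-(m : ℤ)) m, fourier (-k) θ • star (A k) := by
    intro θ
    rw [hA, star_sum]
    refine Finset.sum_congr rfl fun k _ => ?_
    rw [star_smul, fourier_neg]
    rfl
  rw [funext this]
  refine IsLaurentPoly.sum fun k hk => isLaurentPoly_monomial ?_ _
  rw [Finset.mem_Icc] at *
  omega

theorem inv_mem_OmegaAlgM {m : ℕ} {γ : Circ → UN N} (h : γ ∈ OmegaAlgM K m) :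
    (fun θ => (γ θ)⁻¹) ∈ OmegaAlgM K m := by
  obtain ⟨h1, h2, h3⟩ := h
  refine ⟨fun θ => K.inv_mem (h1 θ), ?_, isLaurentPoly_star h3⟩
  change (γ 0)⁻¹ = 1
  rw [h2, inv_one]

theorem mul_mem_OmegaAlgM {m n : ℕ} {γ δ : Circ → UN N} (h : γ ∈ OmegaAlgM K m)
    (h' : δ ∈ OmegaAlgM K n) : (fun θ => γ θ * δ θ) ∈ OmegaAlgM K (m + n) := by
  refine ⟨fun θ => K.mul_mem (h.1 θ) (h'.1 θ), ?_, ?_⟩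
  · change γ 0 * δ 0 = 1
    rw [h.2.1, h'.2.1, one_mul]
  · exact IsLaurentPoly.bilin h.2.2 h'.2.2 (LinearMap.mul ℂ (Mat N))

theorem hasDerivAt_laurent {m : ℕ} {F : Circ → Mat N} (hF : IsLaurentPoly m F) (x : ℝ) :
    ∃ F' : Mat N, HasDerivAt (fun s : ℝ => F (s : Circ)) F' x := by
  obtain ⟨A, hA⟩ := hF
  refine ⟨Matrix.of fun i j => ∑ k ∈ Finset.Icc (-(m : ℤ)) m,
    2 * π * Complex.I * k / ((2 * π : ℝ) : ℂ) * fourier k (x : Circ) * A k i j, ?_⟩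
  rw [hasDerivAt_mat]
  intro i j
  have : (fun s : ℝ => F (s : Circ) i j) =
      fun s : ℝ => ∑ k ∈ Finset.Icc (-(m : ℤ)) m, fourier k (s : Circ) * A k i j := by
    funext s
    rw [hA, Matrix.sum_apply]
    rfl
  rw [this]
  exact HasDerivAt.fun_sum fun k _ => (hasDerivAt_fourier (2 * π) k x).mul_const _

/-- A Laurent polynomial loop in `K` that centralizes `𝔨` is constant. -/
theorem eq_one_of_centralizes [LieAlgebra.IsKilling ℝ (lieAlg K)] {m : ℕ} {g : Circ → UN N}
    (hg : g ∈ OmegaAlgM K m) (hc : ∀ θ, ∀ Z ∈ lieAlg K, (g θ : Mat N) * Z = Z * (g θ : Mat N))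
    (θ : Circ) : g θ = 1 := by
  have hconst : ∀ P : Mat N, ∀ x : ℝ, HasDerivAt (fun _ : ℝ => P) 0 x := by
    intro P x
    rw [hasDerivAt_mat]; intro i j; exact hasDerivAt_const _ _
  have hderiv : ∀ x : ℝ, HasDerivAt (fun s : ℝ => (g (s : Circ) : Mat N)) 0 x := by
    intro x
    obtain ⟨F', hF'⟩ := hasDerivAt_laurent hg.2.2 x
    have hu : star (g (x : Circ) : Mat N) * (g (x : Circ) : Mat N) = 1 :=
      Unitary.coe_star_mul_self _
    have hu' : (g (x : Circ) : Mat N) * star (g (x : Circ) : Mat N) = 1 :=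
      Unitary.coe_mul_star_self _
    have hshift : HasDerivAt (fun s : ℝ => (g ((x + s : ℝ) : Circ) : Mat N)) F' 0 := by
      rw [hasDerivAt_mat] at hF' ⊢
      intro i j
      exact HasDerivAt.comp_const_add x 0 (by rw [add_zero]; exact hF' i j)
    have hX : HasDerivAt (fun s : ℝ =>
        (((g (x : Circ))⁻¹ * g ((x + s : ℝ) : Circ) : UN N) : Mat N))
        (star (g (x : Circ) : Mat N) * F') 0 := by
      have h1 := hasDerivAt_mul (hconst (star (g (x : Circ) : Mat N)) 0) hshift
      rw [zero_mul, zero_add] at h1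
      exact h1
    -- The curve `s ↦ g(x)⁻¹ g(x + s)` lies in `K` and passes through `1`, so its velocity `g⁻¹g'`
    -- belongs to `𝔨`.
    have hXmem : star (g (x : Circ) : Mat N) * F' ∈ lieAlg K :=
      ⟨_, fun s => K.mul_mem (K.inv_mem (hg.1 _)) (hg.1 _), by simp, hX⟩
    have hcomm : ∀ Z ∈ lieAlg K, F' * Z = Z * F' := by
      intro Z hZ
      have h1 := hasDerivAt_mul hF' (hconst Z x)
      have h2 := hasDerivAt_mul (hconst Z x) hF'
      simp only [hc _ Z hZ] at h1
      rw [hasDerivAt_mat] at h1 h2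
      ext i j
      have h3 := (h1 i j).unique (h2 i j)
      simpa using h3
    -- Both `g` and `g'` commute with `𝔨`, hence so does `g⁻¹g'`; the centre is trivial since the
    -- Killing form is non-degenerate.
    have hzero : (⟨_, hXmem⟩ : lieAlg K) = 0 := by
      have hm : (⟨_, hXmem⟩ : lieAlg K) ∈ LieAlgebra.center ℝ (lieAlg K) := by
        rw [LieModule.mem_maxTrivSubmodule]
        intro Z
        refine Subtype.ext ?_
        change (Z : Mat N) * (star (g (x : Circ) : Mat N) * F') -
          star (g (x : Circ) : Mat N) * F' * (Z : Mat N) = 0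
        have h4 : (Z : Mat N) * star (g (x : Circ) : Mat N) =
            star (g (x : Circ) : Mat N) * (Z : Mat N) := by
          calc (Z : Mat N) * star (g (x : Circ) : Mat N)
              = star (g (x : Circ) : Mat N) * ((g (x : Circ) : Mat N) * (Z : Mat N)) *
                  star (g (x : Circ) : Mat N) := by
                rw [← mul_assoc, hu, one_mul]
            _ = star (g (x : Circ) : Mat N) * (Z : Mat N) *
                  ((g (x : Circ) : Mat N) * star (g (x : Circ) : Mat N)) := by
                rw [hc _ Z Z.2]; simp only [mul_assoc]
            _ = _ := by rw [hu', mul_one]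
        rw [← mul_assoc, h4, mul_assoc, mul_assoc, hcomm Z Z.2, sub_self]
      rw [LieAlgebra.center_eq_bot] at hm
      exact (LieSubmodule.mem_bot _).1 hm
    have h5 : star (g (x : Circ) : Mat N) * F' = 0 := congrArg Subtype.val hzero
    have h6 : F' = 0 := by
      calc F' = (g (x : Circ) : Mat N) * (star (g (x : Circ) : Mat N) * F') := by
            rw [← mul_assoc, hu', one_mul]
        _ = 0 := by rw [h5, mul_zero]
    rwa [h6] at hF'
  obtain ⟨x, rfl⟩ := QuotientAddGroup.mk_surjective θ
  apply Subtype.ext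
  ext i j
  have h1 : ∀ y : ℝ, HasDerivAt (fun s : ℝ => (g (s : Circ) : Mat N) i j) 0 y := fun y =>
    hasDerivAt_mat.1 (hderiv y) i j
  have h2 := is_const_of_deriv_eq_zero (fun y => (h1 y).differentiableAt)
    (fun y => (h1 y).deriv) x 0
  have h3 : g ((0 : ℝ) : Circ) = 1 := hg.2.1
  rw [h3] at h2
  exact h2

end LoopGroup

/-! ### The unitary action of loops on `L²(S¹, 𝔨_ℂ)`, and injectivity of `φ` -/

section Action

variable {N : ℕ} {K : Subgroup (UN N)} [LieAlgebra.IsKilling ℝ (lieAlg K)]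

/-- `γ A γ*` is bilinear in `γ` and `γ*`, both of degree `m`. The expansion is first found among
maps into matrices and then pulled back. -/
theorem isLaurentPoly_adK {m : ℕ} {γ : Circ → UN N} (h : γ ∈ OmegaAlgM K m) :
    IsLaurentPoly (m + m) fun θ => adK K (γ θ) := by
  let f : (KC K →L[ℂ] KC K) →ₗ[ℂ] (KC K → Mat N) :=
    { toFun := fun T A => (T A).val
      map_add' := fun _ _ => rfl
      map_smul' := fun _ _ => rfl }
  have hf : Function.Injective f := fun S T hST =>
    ContinuousLinearMap.ext fun A => KC.val_injective (congrFun hST A)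
  refine IsLaurentPoly.of_injective hf ?_
  let B : Mat N →ₗ[ℂ] Mat N →ₗ[ℂ] (KC K → Mat N) :=
    LinearMap.mk₂ ℂ (fun P Q A => P * A.val * Q)
      (fun P P' Q => by funext A; simp only [add_mul]; rfl)
      (fun z P Q => by funext A; simp only [smul_mul_assoc]; rfl)
      (fun P Q Q' => by funext A; simp only [mul_add]; rfl)
      (fun z P Q => by funext A; simp only [mul_smul_comm]; rfl)
  have h1 : (fun θ => f (adK K (γ θ))) = fun θ => B (γ θ : Mat N) (star (γ θ : Mat N)) := by
    funext θ A
    exact val_adLin (h.1 θ) A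
  rw [h1]
  exact IsLaurentPoly.bilin h.2.2 (isLaurentPoly_star h.2.2) B

/-- The loop `θ ↦ Ad γ(θ)`, as a Laurent polynomial of degree `n`. -/
def adMap (K : Subgroup (UN N)) [LieAlgebra.IsKilling ℝ (lieAlg K)] (n : ℕ) (γ : Circ → UN N) :
    C(Circ, KC K →L[ℂ] KC K) := interp n fun θ => adK K (γ θ)

/-- The degree `n` is left free above `2m`, so that all loops of a curve can share one interpolation
degree. -/
theorem adMap_apply {m n : ℕ} (hn : m + m ≤ n) {γ : Circ → UN N} (h : γ ∈ OmegaAlgM K m)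
    (θ : Circ) : adMap K n γ θ = adK K (γ θ) :=
  interp_apply ((isLaurentPoly_adK h).mono hn) θ

theorem adMap_mem_Hge (n : ℕ) (γ : Circ → UN N) {a b : ℤ} (hab : b ≤ a - n) {f : HK K}
    (hf : f ∈ Hge a) : mulOp (adMap K n γ) f ∈ Hge b :=
  mulOp_lpoly_mem_Hge n _ hab hf

theorem adMap_inv_mul {m n : ℕ} (hn : m + m ≤ n) {γ : Circ → UN N} (h : γ ∈ OmegaAlgM K m) :
    adMap K n (fun θ => (γ θ)⁻¹) * adMap K n γ = 1 := by
  ext θ A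
  change adMap K n (fun θ => (γ θ)⁻¹) θ (adMap K n γ θ A) = A
  rw [adMap_apply hn (inv_mem_OmegaAlgM h), adMap_apply hn h, adK_apply, adK_apply, ← adLin_mul (h.1 θ),
    inv_mul_cancel, adLin_one]

theorem adMap_mul_inv {m n : ℕ} (hn : m + m ≤ n) {γ : Circ → UN N} (h : γ ∈ OmegaAlgM K m) :
    adMap K n γ * adMap K n (fun θ => (γ θ)⁻¹) = 1 := by
  ext θ A
  change adMap K n γ θ (adMap K n (fun θ => (γ θ)⁻¹) θ A) = A
  rw [adMap_apply hn (inv_mem_OmegaAlgM h), adMap_apply hn h, adK_apply, adK_apply,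
    ← adLin_mul (K.inv_mem (h.1 θ)), mul_inv_cancel, adLin_one]

theorem inner_mulOp_adMap {m n : ℕ} (hn : m + m ≤ n) {γ : Circ → UN N} (h : γ ∈ OmegaAlgM K m)
    (f g : HK K) : ⟪mulOp (adMap K n γ) f, mulOp (adMap K n γ) g⟫_ℂ = ⟪f, g⟫_ℂ := by
  rw [L2.inner_def, L2.inner_def]
  refine integral_congr_ae ?_
  filter_upwards [coeFn_mulOp (adMap K n γ) f, coeFn_mulOp (adMap K n γ) g] with θ h1 h2
  rw [h1, h2, adMap_apply hn h, adK_apply, adK_apply, inner_adLin (h.1 θ)]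

/-- The unitary operator `f ↦ Ad_γ f` of `L²(S¹, 𝔨_ℂ)`. -/
def adU {m : ℕ} {γ : Circ → UN N} (h : γ ∈ OmegaAlgM K m) : HK K ≃ₗᵢ[ℂ] HK K where
  toFun := mulOp (adMap K (m + m) γ)
  invFun := mulOp (adMap K (m + m) fun θ => (γ θ)⁻¹)
  map_add' := map_add _
  map_smul' := map_smul _
  left_inv f := by rw [← mulOp_mul, adMap_inv_mul le_rfl h, mulOp_one]
  right_inv f := by rw [← mulOp_mul, adMap_mul_inv le_rfl h, mulOp_one]
  norm_map' f := by
    have := inner_mulOp_adMap le_rfl h f f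
    rw [inner_self_eq_norm_sq_to_K, inner_self_eq_norm_sq_to_K] at this
    have h2 : ‖mulOp (adMap K (m + m) γ) f‖ ^ 2 = ‖f‖ ^ 2 := by exact_mod_cast this
    exact (pow_left_inj₀ (norm_nonneg _) (norm_nonneg _) two_ne_zero).1 h2

theorem adU_apply {m n : ℕ} {γ : Circ → UN N} (h : γ ∈ OmegaAlgM K m) (hn : m + m ≤ n)
    (f : HK K) : adU h f = mulOp (adMap K n γ) f := by
  have : adMap K (m + m) γ = adMap K n γ := by
    ext1 θ
    rw [adMap_apply le_rfl h, adMap_apply hn h]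
  rw [← this]
  rfl

theorem adU_symm_apply {m n : ℕ} {γ : Circ → UN N} (h : γ ∈ OmegaAlgM K m) (hn : m + m ≤ n)
    (f : HK K) : (adU h).symm f = mulOp (adMap K n fun θ => (γ θ)⁻¹) f := by
  have : adMap K (m + m) (fun θ => (γ θ)⁻¹) = adMap K n fun θ => (γ θ)⁻¹ := by
    ext1 θ
    rw [adMap_apply le_rfl (inv_mem_OmegaAlgM h), adMap_apply hn (inv_mem_OmegaAlgM h)]
  rw [← this]
  rfl

theorem val_adU {m : ℕ} {γ : Circ → UN N} (h : γ ∈ OmegaAlgM K m) (f : HK K) :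
    ∀ᵐ θ ∂circMeasure, (adU h f θ).val = (γ θ : Mat N) * (f θ).val * star (γ θ : Mat N) := by
  filter_upwards [coeFn_mulOp (adMap K (m + m) γ) f] with θ h1
  rw [adU_apply h le_rfl, h1, adMap_apply le_rfl h, adK_apply, val_adLin (h.1 θ)]

theorem phi_eq_map {m : ℕ} {γ : Circ → UN N} (h : γ ∈ OmegaAlgM K m) :
    phi K γ = (hPlus (KC K)).map ((adU h).toLinearEquiv : HK K →ₗ[ℂ] HK K) := by
  ext g
  constructor
  · rintro ⟨f, hf, hg⟩
    refine ⟨f, hf, ?_⟩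
    refine Lp.ext ?_
    filter_upwards [hg, val_adU h f] with θ h1 h2
    exact KC.val_injective (h2.trans h1.symm)
  · rintro ⟨f, hf, rfl⟩
    exact ⟨f, hf, val_adU h f⟩

theorem mem_phi_iff {m : ℕ} {γ : Circ → UN N} (h : γ ∈ OmegaAlgM K m) {g : HK K} :
    g ∈ phi K γ ↔ (adU h).symm g ∈ hPlus (KC K) := by
  rw [phi_eq_map h]
  constructor
  · rintro ⟨f, hf, rfl⟩
    change (adU h).symm (adU h f) ∈ _
    rwa [LinearIsometryEquiv.symm_apply_apply]
  · intro hg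
    exact ⟨_, hg, (adU h).apply_symm_apply g⟩

theorem adU_mem_phi_iff {m : ℕ} {γ : Circ → UN N} (h : γ ∈ OmegaAlgM K m) {f : HK K} :
    adU h f ∈ phi K γ ↔ f ∈ hPlus (KC K) := by
  rw [mem_phi_iff h, LinearIsometryEquiv.symm_apply_apply]

theorem adU_mem_phi_orthogonal {m : ℕ} {γ : Circ → UN N} (h : γ ∈ OmegaAlgM K m) {f : HK K}
    (hf : f ∈ (hPlus (KC K))ᗮ) : adU h f ∈ (phi K γ)ᗮ := by
  rw [Submodule.mem_orthogonal]
  intro g hg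
  rw [← (adU h).apply_symm_apply g, LinearIsometryEquiv.inner_map_map]
  exact (Submodule.mem_orthogonal _ _).1 hf _ ((mem_phi_iff h).1 hg)

theorem isClosed_phi {m : ℕ} {γ : Circ → UN N} (h : γ ∈ OmegaAlgM K m) :
    IsClosed (phi K γ : Set (HK K)) := by
  have h1 : (phi K γ : Set (HK K)) = (adU h).symm ⁻¹' (hPlus (KC K) : Set (HK K)) := by
    ext g
    exact mem_phi_iff h
  rw [h1]
  exact (Submodule.isClosed_topologicalClosure _).preimage (adU h).symm.continuous

theorem Hge_le_phi {m : ℕ} {γ : Circ → UN N} (h : γ ∈ OmegaAlgM K m) {n : ℕ} (hn : m + m ≤ n) :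
    Hge (n : ℤ) ≤ phi K γ := by
  intro f hf
  rw [mem_phi_iff h, adU_symm_apply h hn, hPlus_eq_Hge]
  exact adMap_mem_Hge n _ (by omega) hf

theorem phi_le_Hge {m : ℕ} {γ : Circ → UN N} (h : γ ∈ OmegaAlgM K m) {n : ℕ} (hn : m + m ≤ n) :
    phi K γ ≤ Hge (-(n : ℤ)) := by
  intro f hf
  rw [← (adU h).apply_symm_apply f, adU_apply h hn]
  exact adMap_mem_Hge n _ (by omega) (hPlus_le_Hge ((mem_phi_iff h).1 hf))

theorem phi_mem_GrZero {γ : Circ → UN N} (hγ : γ ∈ OmegaAlg K) : phi K γ ∈ GrZero (KC K) := by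
  obtain ⟨m, h⟩ := Set.mem_iUnion.1 hγ
  exact mem_GrZero_of_le (isClosed_phi h) (Hge_le_phi h le_rfl) (phi_le_Hge h le_rfl)

/-- Since `Ad_g` and its inverse both preserve `H₊`, the loop `θ ↦ Ad_{g(θ)} A` has only its
constant mode, and its value at the base point is `A`. -/
theorem adLin_eq_self_of_phi_eq {m : ℕ} {g : Circ → UN N} (h : g ∈ OmegaAlgM K m)
    (hg : phi K g = hPlus (KC K)) (θ : Circ) (A : KC K) : adLin K (g θ) A = A := by
  let c : ℤ → KC K →L[ℂ] KC K := dftCoeff (m + m) fun θ => adK K (g θ)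
  have hmono : adU h (mono 0 A) = ∑ k ∈ Finset.Icc (-((m + m : ℕ) : ℤ)) (m + m : ℕ), mono k (c k A) := by
    rw [adU_apply h le_rfl]
    refine (mulOp_lpoly_mono (m + m) c 0 A).trans ?_
    simp only [add_zero]
  have hinner : ∀ k ∈ Finset.Icc (-((m + m : ℕ) : ℤ)) (m + m : ℕ), ∀ δ : KC K,
      ⟪mono k δ, adU h (mono 0 A)⟫_ℂ = ⟪δ, c k A⟫_ℂ := by
    intro k hk δ
    rw [hmono, inner_sum, Finset.sum_eq_single k]
    · rw [inner_mono_mono, if_pos rfl]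
    · intro l _ hl
      rw [inner_mono_mono, if_neg hl.symm]
    · exact fun h' => absurd hk h'
  have hzero : ∀ k ∈ Finset.Icc (-((m + m : ℕ) : ℤ)) (m + m : ℕ), k ≠ 0 → c k A = 0 := by
    intro k hk hk0
    rw [← inner_self_eq_zero (𝕜 := ℂ), ← hinner k hk]
    rcases lt_or_gt_of_ne hk0 with hneg | hpos
    · have h1 : adU h (mono 0 A) ∈ phi K g := (adU_mem_phi_iff h).2 (mono_mem_hPlus le_rfl A)
      rw [hg] at h1
      exact hPlus_le_Hge h1 k hneg _
    -- Positive modes: `Ad_g⁻¹` commutes with `z ^ k` and preserves `H₊`, so it sends `z ^ k c` into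
    -- `z H₊`, which is orthogonal to the constant `A`.
    · have h1 : (adU h).symm (mono k (c k A)) ∈ Hge 1 := by
        rw [adU_symm_apply h le_rfl]
        have h2 : mono k (c k A) = mulOp (trig k 1) (mono 0 (c k A)) := by
          rw [mulOp_trig_mono, add_zero]; rfl
        have h3 : mulOp (adMap K (m + m) fun θ => (g θ)⁻¹) (mulOp (trig k 1) (mono 0 (c k A))) =
            mulOp (trig k 1) (mulOp (adMap K (m + m) fun θ => (g θ)⁻¹) (mono 0 (c k A))) := by
          rw [← mulOp_mul, ← mulOp_mul]
          congr 2
          ext θ B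
          change adMap K (m + m) (fun θ => (g θ)⁻¹) θ (fourier k θ • B) =
            fourier k θ • adMap K (m + m) (fun θ => (g θ)⁻¹) θ B
          rw [map_smul]
        rw [h2, h3]
        refine mulOp_trig_mem_Hge (m := 0) k _ (by omega) ?_
        rw [← hPlus_eq_Hge, ← adU_symm_apply h le_rfl, ← mem_phi_iff h, hg]
        exact mono_mem_hPlus le_rfl _
      rw [← LinearIsometryEquiv.inner_map_map (adU h).symm, LinearIsometryEquiv.symm_apply_apply,
        ← inner_conj_symm, h1 0 (by omega), map_zero]
  have hval : ∀ θ, adLin K (g θ) A = c 0 A := by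
    intro θ
    rw [← adK_apply, (isLaurentPoly_adK h).eq_sum_dftCoeff θ, sum_apply,
      Finset.sum_eq_single 0]
    · rw [smul_apply, fourier_zero, one_smul]
    · intro k hk hk0
      rw [smul_apply, hzero k hk hk0, smul_zero]
    · intro h'
      exact absurd (Finset.mem_Icc.2 ⟨by omega, by omega⟩) h'
  rw [hval, ← hval 0, h.2.1, adLin_one]

theorem injOn_phi : Set.InjOn (phi K) (OmegaAlg K) := by
  intro γ hγ δ hδ heq
  obtain ⟨m, h⟩ := Set.mem_iUnion.1 hγ
  obtain ⟨n, h'⟩ := Set.mem_iUnion.1 hδ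
  have hg := mul_mem_OmegaAlgM (inv_mem_OmegaAlgM h') h
  have hphi : phi K (fun θ => (δ θ)⁻¹ * γ θ) = hPlus (KC K) := by
    have key : ∀ f, adU hg f = (adU h').symm (adU h f) := by
      intro f
      rw [LinearIsometryEquiv.eq_symm_apply]
      refine Lp.ext ?_
      filter_upwards [val_adU h' (adU hg f), val_adU hg f, val_adU h f] with θ h1 h2 h3
      apply KC.val_injective
      rw [h1, h2, h3]
      have h4 : (δ θ : Mat N) * (((δ θ)⁻¹ * γ θ : UN N) : Mat N) = (γ θ : Mat N) := by
        rw [← Submonoid.coe_mul, mul_inv_cancel_left]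
      have h5 : star (((δ θ)⁻¹ * γ θ : UN N) : Mat N) * star (δ θ : Mat N) =
          star (γ θ : Mat N) := by
        rw [← star_mul, h4]
      calc _ = ((δ θ : Mat N) * (((δ θ)⁻¹ * γ θ : UN N) : Mat N)) * (f θ).val *
            (star (((δ θ)⁻¹ * γ θ : UN N) : Mat N) * star (δ θ : Mat N)) := by
              simp only [mul_assoc]
        _ = _ := by rw [h4, h5]
    ext f
    rw [phi_eq_map hg]
    constructor
    · rintro ⟨u, hu, rfl⟩
      change adU hg u ∈ _
      rw [key, ← mem_phi_iff h', ← heq, adU_mem_phi_iff h]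
      exact hu
    · intro hf
      refine ⟨(adU h).symm (adU h' f), ?_, ?_⟩
      · change _ ∈ hPlus (KC K)
        rw [← mem_phi_iff h, heq, adU_mem_phi_iff h']
        exact hf
      · change adU hg _ = f
        rw [key, LinearIsometryEquiv.apply_symm_apply, LinearIsometryEquiv.symm_apply_apply]
  funext θ
  have h1 := eq_one_of_centralizes hg (fun θ Z hZ => by
    have h2 := congrArg KC.val (adLin_eq_self_of_phi_eq hg hphi θ (KC.ofReal ⟨Z, hZ⟩))
    rw [val_adLin (hg.1 θ)] at h2
    have h3 : star (((δ θ)⁻¹ * γ θ : UN N) : Mat N) * (((δ θ)⁻¹ * γ θ : UN N) : Mat N) = 1 :=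
      Unitary.coe_star_mul_self _
    have h4 := congrArg (· * (((δ θ)⁻¹ * γ θ : UN N) : Mat N)) h2
    simp only [mul_assoc, h3, mul_one] at h4
    exact h4) θ
  exact (inv_mul_eq_one.1 h1).symm

end Action

/-! ### The differential of `φ` -/

section Differential

variable {N : ℕ} {K : Subgroup (UN N)} [LieAlgebra.IsKilling ℝ (lieAlg K)]

theorem exists_isLaurentPoly_ofReal (X : OmegaAlgLie K) :
    ∃ m, IsLaurentPoly m fun θ => KC.ofReal (X.1 θ) := by
  obtain ⟨m, hm⟩ := X.2.2
  exact ⟨m, IsLaurentPoly.of_injective (f := KC.valLin K) KC.val_injective hm⟩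

/-- The coefficients of a loop `X` of degree at most `n` in `𝔨`. -/
def lieCoeff (n : ℕ) (X : OmegaAlgLie K) (k : ℤ) : KC K :=
  dftCoeff n (fun θ => KC.ofReal (X.1 θ)) k

theorem ofReal_eq_sum {n : ℕ} {X : OmegaAlgLie K}
    (hX : IsLaurentPoly n fun θ => KC.ofReal (X.1 θ)) (θ : Circ) :
    KC.ofReal (X.1 θ) = ∑ k ∈ Finset.Icc (-(n : ℤ)) n, fourier k θ • lieCoeff n X k :=
  hX.eq_sum_dftCoeff θ

theorem adC_ofReal_eq {n : ℕ} {X : OmegaAlgLie K}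
    (hX : IsLaurentPoly n fun θ => KC.ofReal (X.1 θ)) (θ : Circ) :
    adC K (KC.ofReal (X.1 θ)) = lpoly n (fun k => adC K (lieCoeff n X k)) θ := by
  rw [lpoly_apply, ofReal_eq_sum hX, map_sum]
  simp only [map_smul]

/-- The loop `θ ↦ ad X(θ)`. -/
def lieMap (K : Subgroup (UN N)) [LieAlgebra.IsKilling ℝ (lieAlg K)] :
    OmegaAlgLie K →ₗ[ℝ] C(Circ, KC K →L[ℂ] KC K) where
  toFun X := ⟨fun θ => adC K (KC.ofReal (X.1 θ)), by
    obtain ⟨m, hm⟩ := exists_isLaurentPoly_ofReal X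
    rw [funext (adC_ofReal_eq hm)]
    exact (lpoly m _).continuous⟩
  map_add' X Y := ContinuousMap.ext fun θ =>
    (congrArg (adC K) (map_add (KC.ofRealLin K) (X.1 θ) (Y.1 θ))).trans (map_add (adC K) _ _)
  map_smul' r X := ContinuousMap.ext fun θ =>
    (congrArg (adC K) (KC.coe_smul_ofReal r (X.1 θ)).symm).trans (map_smul (adC K) (r : ℂ) _)

theorem lieMap_apply (X : OmegaAlgLie K) (θ : Circ) :
    lieMap K X θ = adC K (KC.ofReal (X.1 θ)) := rfl

theorem lieMap_eq_lpoly {n : ℕ} {X : OmegaAlgLie K}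
    (hX : IsLaurentPoly n fun θ => KC.ofReal (X.1 θ)) :
    lieMap K X = lpoly n fun k => adC K (lieCoeff n X k) :=
  ContinuousMap.ext (adC_ofReal_eq hX)

/-- The values of `X` are skew-Hermitian; expanding `X = -X*` gives a second expansion of `X`, and
coefficients are unique. -/
theorem lieCoeff_neg {n : ℕ} {X : OmegaAlgLie K}
    (hX : IsLaurentPoly n fun θ => KC.ofReal (X.1 θ)) {k : ℤ}
    (hk : k ∈ Finset.Icc (-(n : ℤ)) n) : lieCoeff n X (-k) = -(lieCoeff n X k).conjT := by
  let conjLin : KC K →+ KC K := AddMonoidHom.mk' KC.conjT KC.conjT_add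
  have h : ∀ θ, KC.ofReal (X.1 θ) = ∑ l ∈ Finset.Icc (-(n : ℤ)) n,
      fourier l θ • -(lieCoeff n X (-l)).conjT := by
    intro θ
    have h1 : KC.ofReal (X.1 θ) = -(KC.ofReal (X.1 θ)).conjT := by
      rw [KC.conjT_ofReal, neg_neg]
    have h2 : (KC.ofReal (X.1 θ)).conjT = ∑ l ∈ Finset.Icc (-(n : ℤ)) n,
        fourier (-l) θ • (lieCoeff n X l).conjT := by
      rw [ofReal_eq_sum hX]
      refine (map_sum conjLin _ _).trans (Finset.sum_congr rfl fun l _ => ?_)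
      change (fourier l θ • lieCoeff n X l).conjT = _
      rw [KC.conjT_smul, fourier_neg]
    rw [h1, h2, ← Finset.sum_neg_distrib]
    refine Finset.sum_nbij' (fun l => -l) (fun l => -l) ?_ ?_ ?_ ?_ ?_
    · intro l hl; rw [Finset.mem_Icc] at *; omega
    · intro l hl; rw [Finset.mem_Icc] at *; omega
    · intro l _; exact neg_neg l
    · intro l _; exact neg_neg l
    · intro l _; rw [neg_neg, smul_neg]
  have hk' : -k ∈ Finset.Icc (-(n : ℤ)) n := by rw [Finset.mem_Icc] at *; omega
  have := dftCoeff_eq h hk'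
  rw [neg_neg] at this
  exact this

/-- The operator `f ↦ [Ad_γ X, f]`. -/
def conjOp {m : ℕ} {γ : Circ → UN N} (h : γ ∈ OmegaAlgM K m) (X : OmegaAlgLie K) :
    HK K →L[ℂ] HK K :=
  ((adU h).toContinuousLinearEquiv : HK K →L[ℂ] HK K) ∘L mulOp (lieMap K X) ∘L
    ((adU h).symm.toContinuousLinearEquiv : HK K →L[ℂ] HK K)

theorem conjOp_apply {m : ℕ} {γ : Circ → UN N} (h : γ ∈ OmegaAlgM K m) (X : OmegaAlgLie K)
    (f : HK K) : conjOp h X f = adU h (mulOp (lieMap K X) ((adU h).symm f)) := rfl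

/-- The differential of `φ` at `γ`. -/
def phiDiff {m : ℕ} {γ : Circ → UN N} (h : γ ∈ OmegaAlgM K m) :
    OmegaAlgLie K →ₗ[ℝ] (phi K γ →L[ℂ] (phi K γ)ᗮ) where
  toFun X := (phi K γ)ᗮ.orthogonalProjectionOnto ∘L conjOp h X ∘L (phi K γ).subtypeL
  map_add' X Y := by
    ext1 w
    change (phi K γ)ᗮ.orthogonalProjectionOnto (conjOp h (X + Y) w) =
      (phi K γ)ᗮ.orthogonalProjectionOnto (conjOp h X w) +
        (phi K γ)ᗮ.orthogonalProjectionOnto (conjOp h Y w)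
    simp only [conjOp_apply]
    rw [← map_add, ← map_add, map_add (lieMap K), map_add mulOp, add_apply]
  map_smul' r X := by
    ext1 w
    change (phi K γ)ᗮ.orthogonalProjectionOnto (conjOp h (r • X) w) =
      (r : ℂ) • (phi K γ)ᗮ.orthogonalProjectionOnto (conjOp h X w)
    simp only [conjOp_apply]
    have h1 : lieMap K (r • X) = (r : ℂ) • lieMap K X := map_smul (lieMap K) r X
    rw [← map_smul, ← map_smul, h1, map_smul mulOp, smul_apply]

theorem phiDiff_apply {m : ℕ} {γ : Circ → UN N} (h : γ ∈ OmegaAlgM K m) (X : OmegaAlgLie K)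
    (w : phi K γ) :
    phiDiff h X w = (phi K γ)ᗮ.orthogonalProjectionOnto (conjOp h X w) := rfl

/-- Pointwise `Ad_γ ad(X) Ad_γ⁻¹ = ad(Ad_γ X)`; the correction `u` is the component in `W` that the
projection to `Wᗮ` drops. -/
theorem phiDiff_formula {m : ℕ} {γ : Circ → UN N} (h : γ ∈ OmegaAlgM K m) (X : OmegaAlgLie K)
    (w : phi K γ) : ∃ u : phi K γ, ∀ᵐ θ ∂circMeasure,
      ((phiDiff h X w + u : HK K) θ).val =
        ⁅(γ θ : Mat N) * (X.1 θ : Mat N) * ((γ θ)⁻¹ : UN N), ((w : HK K) θ).val⁆ := by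
  have : CompleteSpace (phi K γ) := (isClosed_phi h).completeSpace_coe
  refine ⟨(phi K γ).orthogonalProjectionOnto (conjOp h X w), ?_⟩
  have h1 : (phiDiff h X w : HK K) + (phi K γ).orthogonalProjectionOnto (conjOp h X w) =
      conjOp h X w := by
    rw [add_comm]
    exact (phi K γ).starProjection_add_starProjection_orthogonal (conjOp h X w)
  rw [h1, conjOp_apply]
  have h2 := val_adU h ((adU h).symm w)
  rw [LinearIsometryEquiv.apply_symm_apply] at h2
  filter_upwards [h2, val_adU h (mulOp (lieMap K X) ((adU h).symm w)),
    coeFn_mulOp (lieMap K X) ((adU h).symm (w : HK K))] with θ h3 h4 h5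
  rw [h3, h4, h5, lieMap_apply, adC_apply, KC.val_lie, KC.val_ofReal]
  have hu : star (γ θ : Mat N) * (γ θ : Mat N) = 1 := Unitary.coe_star_mul_self _
  have hu' : ∀ P : Mat N, star (γ θ : Mat N) * ((γ θ : Mat N) * P) = P := fun P => by
    rw [← mul_assoc, hu, one_mul]
  change _ = (γ θ : Mat N) * (X.1 θ : Mat N) * star (γ θ : Mat N) * _ -
    _ * ((γ θ : Mat N) * (X.1 θ : Mat N) * star (γ θ : Mat N))
  simp only [mul_assoc, hu', mul_sub, sub_mul]

theorem conjOp_mem_Hge {m : ℕ} {γ : Circ → UN N} (h : γ ∈ OmegaAlgM K m) {X : OmegaAlgLie K}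
    {l : ℕ} (hX : IsLaurentPoly l fun θ => KC.ofReal (X.1 θ)) {n : ℕ} (hn : m + m + l ≤ n)
    {f : HK K} (hf : f ∈ phi K γ) : conjOp h X f ∈ Hge (-(n : ℤ)) := by
  rw [conjOp_apply, adU_apply h le_rfl]
  refine adMap_mem_Hge (a := -(l : ℤ)) _ _ (by push_cast; omega) ?_
  rw [lieMap_eq_lpoly hX]
  exact mulOp_lpoly_mem_Hge (m := 0) l _ (by omega) (hPlus_le_Hge ((mem_phi_iff h).1 hf))

theorem isHilbertSchmidt_phiDiff {m : ℕ} {γ : Circ → UN N} (h : γ ∈ OmegaAlgM K m)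
    (X : OmegaAlgLie K) : IsHilbertSchmidt (phiDiff h X) := by
  have : CompleteSpace (phi K γ) := (isClosed_phi h).completeSpace_coe
  obtain ⟨l, hX⟩ := exists_isLaurentPoly_ofReal X
  exact isHilbertSchmidt_of_mem _ fun w => orthogonalProjectionOnto_mem_map_box
    (Hge_le_phi h le_rfl) (conjOp_mem_Hge h hX le_rfl w.2)

/-- The operators `R t = Ad_{c t} Ad_γ⁻¹` carry `φ(γ)` to `φ(c t)` and have derivative `Ad_γ ad(X)
Ad_γ⁻¹` at `0`. -/
theorem hasGrVelocity_phi {m : ℕ} {γ : Circ → UN N} (h : γ ∈ OmegaAlgM K m) (X : OmegaAlgLie K)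
    {c : ℝ → Circ → UN N} (hc : HasLoopVelocity K c γ X) :
    HasGrVelocity (fun t => phi K (c t)) (phi K γ) (phiDiff h X) := by
  have : CompleteSpace (phi K γ) := (isClosed_phi h).completeSpace_coe
  obtain ⟨hc0, ⟨p, hp⟩, hcd⟩ := hc
  obtain ⟨l, hX⟩ := exists_isLaurentPoly_ofReal X
  -- One degree for everything: `2m + l` bounds `Ad_γ ad(X)`, and `2p` bounds `Ad_{c t}` near `0`.
  let n : ℕ := (m + m + l) + (p + p)
  have hnm : m + m ≤ n := by omega
  have hnp : p + p ≤ n := by omega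
  let R : ℝ → HK K →L[ℂ] HK K := fun t =>
    mulOp (adMap K n (c t)) ∘L ((adU h).symm.toContinuousLinearEquiv : HK K →L[ℂ] HK K)
  have hR_apply : ∀ t f, R t f = mulOp (adMap K n (c t)) ((adU h).symm f) := fun _ _ => rfl
  have hR0 : R 0 = 1 := by
    ext1 f
    rw [hR_apply, hc0, ← adU_apply h hnm, LinearIsometryEquiv.apply_symm_apply]
    rfl
  have hslope : ∀ θ, Tendsto (fun t : ℝ => (t : ℂ)⁻¹ • (adK K (c t θ) - adK K (c 0 θ))) (𝓝[≠] 0)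
      (𝓝 (adK K (c 0 θ) ∘L adC K (KC.ofReal (X.1 θ)))) := by
    intro θ
    refine tendsto_slope_adK (c := fun t => c t θ) ?_
    rw [hc0]
    exact hcd θ
  have hlim := tendsto_slope_interp (n := n) hslope
  have hF' : interp n (fun θ => adK K (c 0 θ) ∘L adC K (KC.ofReal (X.1 θ))) =
      adMap K n γ * lieMap K X := by
    ext1 θ
    rw [interp_apply]
    · rw [ContinuousMap.mul_apply, adMap_apply hnm h, lieMap_apply, hc0]
      rfl
    · rw [hc0]
      have h1 := IsLaurentPoly.bilin (isLaurentPoly_adK h) (hX.map (adC K))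
        (LinearMap.mul ℂ (KC K →L[ℂ] KC K))
      exact h1.mono (by omega)
  rw [hF'] at hlim
  have hR : Tendsto (fun t : ℝ => (t : ℂ)⁻¹ • (R t - 1)) (𝓝[≠] 0) (𝓝 (conjOp h X)) := by
    have h1 := (mulOp.continuous.tendsto _).comp hlim
    have h2 := ((((ContinuousLinearMap.compL ℂ (HK K) (HK K) (HK K)).flip
      ((adU h).symm.toContinuousLinearEquiv : HK K →L[ℂ] HK K))).continuous.tendsto _).comp h1
    have h3 : conjOp h X = (ContinuousLinearMap.compL ℂ (HK K) (HK K) (HK K)).flip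
        ((adU h).symm.toContinuousLinearEquiv : HK K →L[ℂ] HK K)
        (mulOp (adMap K n γ * lieMap K X)) := by
      ext1 f
      rw [conjOp_apply, adU_apply h hnm, ← mulOp_mul]
      rfl
    rw [h3]
    refine h2.congr fun t => ?_
    ext1 f
    change mulOp ((t : ℂ)⁻¹ • (adMap K n (c t) - adMap K n (c 0))) ((adU h).symm f) =
      (t : ℂ)⁻¹ • (R t f - f)
    rw [map_smul, map_sub, smul_apply, sub_apply, hc0, ← adU_apply h hnm,
      LinearIsometryEquiv.apply_symm_apply]
    rfl
  refine hasGrVelocity_of_tendsto_slope hR hR0 (by rw [hc0]) ?_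
    ((box (KC K) (-(n : ℤ)) n).map (phi K γ)ᗮ.orthogonalProjectionOnto.toLinearMap) ?_ ?_
  · filter_upwards [hp] with t ht
    ext f
    rw [mem_phi_iff ht]
    constructor
    · intro hf
      refine ⟨adU h ((adU ht).symm f), (adU_mem_phi_iff h).2 hf, ?_⟩
      change R t _ = f
      rw [hR_apply, LinearIsometryEquiv.symm_apply_apply, ← adU_apply ht hnp,
        LinearIsometryEquiv.apply_symm_apply]
    · rintro ⟨w, hw, rfl⟩
      change (adU ht).symm (R t w) ∈ _
      rw [hR_apply, ← adU_apply ht hnp, LinearIsometryEquiv.symm_apply_apply]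
      exact (mem_phi_iff h).1 hw
  -- This holds for all `t`: the interpolant has degree at most `n` whether or not `c t` does.
  · refine Eventually.of_forall fun t w hw => ?_
    refine orthogonalProjectionOnto_mem_map_box (Hge_le_phi h hnm) ?_
    rw [hR_apply]
    exact adMap_mem_Hge n _ (by omega) (hPlus_le_Hge ((mem_phi_iff h).1 hw))
  · exact fun w hw => orthogonalProjectionOnto_mem_map_box (Hge_le_phi h hnm)
      (conjOp_mem_Hge h hX (by omega) hw)

/-- `Ad_γ` maps `H₊` to `W` and `H₋` into `Wᗮ`, so projecting to `Wᗮ` amounts to keeping the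
negative modes of `ad(X) (z ^ k ε)`. -/
theorem phiDiff_mono {m : ℕ} {γ : Circ → UN N} (h : γ ∈ OmegaAlgM K m) {n : ℕ} {X : OmegaAlgLie K}
    (hX : IsLaurentPoly n fun θ => KC.ofReal (X.1 θ)) {k : ℤ} {ε : KC K}
    (hw : adU h (mono k ε) ∈ phi K γ) :
    (phiDiff h X ⟨adU h (mono k ε), hw⟩ : HK K) = adU h (∑ l ∈ Finset.Icc (-(n : ℤ)) n,
      if l + k < 0 then mono (l + k) ⁅lieCoeff n X l, ε⁆ else 0) := by
  rw [phiDiff_apply, conjOp_apply]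
  change ((phi K γ)ᗮ.starProjection (adU h (mulOp (lieMap K X)
    ((adU h).symm (adU h (mono k ε)))))) = _
  rw [LinearIsometryEquiv.symm_apply_apply, lieMap_eq_lpoly hX, mulOp_lpoly_mono, map_sum, map_sum,
    map_sum]
  refine Finset.sum_congr rfl fun l _ => ?_
  rw [adC_apply]
  split_ifs with hl
  · rw [Submodule.starProjection_eq_self_iff]
    exact adU_mem_phi_orthogonal h (mono_mem_hPlus_orthogonal hl _)
  · rw [map_zero, Submodule.starProjection_apply_eq_zero_iff]
    exact Submodule.le_orthogonal_orthogonal _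
      ((adU_mem_phi_iff h).2 (mono_mem_hPlus (not_lt.1 hl) _))

/-- Tested on constants, a vanishing differential makes every negative coefficient of `X` central,
hence zero. Reality removes the positive ones, and a constant `X` vanishes because it does at the
base point. -/
theorem phiDiff_injective {m : ℕ} {γ : Circ → UN N} (h : γ ∈ OmegaAlgM K m) :
    Function.Injective (phiDiff h) := by
  rw [injective_iff_map_eq_zero]
  intro X hX0
  obtain ⟨n, hX⟩ := exists_isLaurentPoly_ofReal X
  have hneg : ∀ k ∈ Finset.Icc (-(n : ℤ)) n, k < 0 → lieCoeff n X k = 0 := by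
    intro k hk hk0
    refine KC.eq_zero_of_lie fun ε => ?_
    have hw : adU h (mono 0 ε) ∈ phi K γ := (adU_mem_phi_iff h).2 (mono_mem_hPlus le_rfl ε)
    have h1 := phiDiff_mono h hX hw
    rw [hX0] at h1
    have h2 : adU h (∑ l ∈ Finset.Icc (-(n : ℤ)) n,
        if l + 0 < 0 then mono (l + 0) ⁅lieCoeff n X l, ε⁆ else 0) = 0 := h1.symm
    rw [LinearIsometryEquiv.map_eq_zero_iff] at h2
    have h3 := congrArg (fun f => ⟪mono k ⁅lieCoeff n X k, ε⁆, f⟫_ℂ) h2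
    simp only [add_zero, inner_zero_right, inner_sum] at h3
    rw [Finset.sum_eq_single k] at h3
    · rw [if_pos hk0, inner_mono_mono, if_pos rfl] at h3
      exact inner_self_eq_zero.1 h3
    · intro l _ hl
      split_ifs
      · rw [inner_mono_mono, if_neg hl.symm]
      · exact inner_zero_right _
    · exact fun h' => absurd hk h'
  have hzero : ∀ k ∈ Finset.Icc (-(n : ℤ)) n, k ≠ 0 → lieCoeff n X k = 0 := by
    intro k hk hk0
    rcases lt_or_gt_of_ne hk0 with hk1 | hk1
    · exact hneg k hk hk1
    · have hk' : -k ∈ Finset.Icc (-(n : ℤ)) n := by rw [Finset.mem_Icc] at *; omega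
      have h1 := lieCoeff_neg hX hk'
      rw [hneg _ hk' (by omega), neg_neg] at h1
      rw [h1, neg_eq_zero]
      exact KC.val_injective (star_zero _)
  have hval : ∀ θ, KC.ofReal (X.1 θ) = lieCoeff n X 0 := by
    intro θ
    rw [ofReal_eq_sum hX, Finset.sum_eq_single 0]
    · rw [fourier_zero, one_smul]
    · intro k hk hk0
      rw [hzero k hk hk0, smul_zero]
    · intro h'
      exact absurd (Finset.mem_Icc.2 ⟨by omega, by omega⟩) h'
  apply Subtype.ext
  funext θ
  have h1 := KC.ofReal_injective ((hval θ).trans (hval 0).symm)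
  rw [h1, X.2.1]
  rfl

end Differential

/-! ### The Hilbert–Schmidt form, the loop form and the Fourier sum -/

section Forms

variable {N : ℕ} {K : Subgroup (UN N)} [LieAlgebra.IsKilling ℝ (lieAlg K)]

/-- Source of the weight `|l|` in the form. The bound on `l` ensures that all `k ≥ 0` with `l + k <
0` are below `n`; for `l ≥ 0` there are none and `toNat` gives `0`. -/
theorem sum_range_ite_neg {n : ℕ} {l : ℤ} (hl : -(n : ℤ) ≤ l) (z : ℂ) :
    ∑ k : Fin n, (if l + ((k : ℕ) : ℤ) < 0 then z else 0) = ((-l).toNat : ℂ) * z := by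
  rw [Fin.sum_univ_eq_sum_range (fun k : ℕ => if l + (k : ℤ) < 0 then z else 0), ← Finset.sum_filter]
  have : (Finset.range n).filter (fun k : ℕ => l + (k : ℤ) < 0) = Finset.range (-l).toNat := by
    ext k
    rw [Finset.mem_filter, Finset.mem_range, Finset.mem_range]
    omega
  rw [this, Finset.sum_const, Finset.card_range, nsmul_eq_mul]

/-- Only the finite orthonormal family `Ad_γ (z ^ k e_j)`, `0 ≤ k < n`, contributes. The sum over
`j` gives `⟨A_l, B_l⟩`, the sum over `k` the multiplicity. -/
theorem hasTraceAdjointMul_phiDiff {m : ℕ} {γ : Circ → UN N} (h : γ ∈ OmegaAlgM K m) {n : ℕ}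
    {X Y : OmegaAlgLie K} (hX : IsLaurentPoly n fun θ => KC.ofReal (X.1 θ))
    (hY : IsLaurentPoly n fun θ => KC.ofReal (Y.1 θ)) :
    HasTraceAdjointMul (phiDiff h X) (phiDiff h Y) (∑ l ∈ Finset.Icc (-(n : ℤ)) n,
      ((-l).toNat : ℂ) * ⟪lieCoeff n X l, lieCoeff n Y l⟫_ℂ) := by
  have : CompleteSpace (phi K γ) := (isClosed_phi h).completeSpace_coe
  let e := stdOrthonormalBasis ℂ (KC K)
  have hw : ∀ (k : Fin n) (j : Fin (Module.finrank ℂ (KC K))),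
      adU h (mono ((k : ℕ) : ℤ) (e j)) ∈ phi K γ := fun k j =>
    (adU_mem_phi_iff h).2 (mono_mem_hPlus (by omega) _)
  let v : Fin n × Fin (Module.finrank ℂ (KC K)) → phi K γ := fun a => ⟨_, hw a.1 a.2⟩
  have hv : Orthonormal ℂ v := by
    rw [orthonormal_iff_ite]
    rintro ⟨k, j⟩ ⟨k', j'⟩
    change ⟪adU h (mono ((k : ℕ) : ℤ) (e j)), adU h (mono ((k' : ℕ) : ℤ) (e j'))⟫_ℂ = _
    rw [LinearIsometryEquiv.inner_map_map, inner_mono_mono, orthonormal_iff_ite.1 e.orthonormal]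
    by_cases hk : k = k'
    · subst hk
      simp
    · have hk' : ((k : ℕ) : ℤ) ≠ ((k' : ℕ) : ℤ) := fun hh => hk (Fin.ext (by exact_mod_cast hh))
      rw [if_neg hk', if_neg fun hh => hk (congrArg Prod.fst hh)]
  -- A vector of `W` orthogonal to the family lies in `Ad_γ z ^ n H₊`; as `ad(Z)` has degree at most
  -- `n`, its image stays in `W` and projects to zero.
  have hvan : ∀ Z : OmegaAlgLie K, IsLaurentPoly n (fun θ => KC.ofReal (Z.1 θ)) →
      ∀ x, (∀ a, ⟪v a, x⟫_ℂ = 0) → phiDiff h Z x = 0 := by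
    intro Z hZ x hx
    have hx1 := (mem_phi_iff h).1 x.2
    have hx2 : (adU h).symm (x : HK K) ∈ Hge (n : ℤ) := by
      intro k hk ε
      rcases lt_or_ge k 0 with hk0 | hk0
      · exact hPlus_le_Hge hx1 k hk0 ε
      · lift k to ℕ using hk0
        have hk' : k < n := by exact_mod_cast hk
        rw [← e.sum_repr ε, map_sum, sum_inner]
        refine Finset.sum_eq_zero fun j _ => ?_
        have h1 := hx (⟨k, hk'⟩, j)
        change ⟪adU h (mono (k : ℤ) (e j)), (x : HK K)⟫_ℂ = 0 at h1
        rw [map_smul, inner_smul_left, ← LinearIsometryEquiv.inner_map_map (adU h),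
          LinearIsometryEquiv.apply_symm_apply, h1, mul_zero]
    rw [phiDiff_apply, Submodule.orthogonalProjectionOnto_eq_zero_iff, conjOp_apply]
    refine Submodule.le_orthogonal_orthogonal _ ((adU_mem_phi_iff h).2 ?_)
    rw [hPlus_eq_Hge, lieMap_eq_lpoly hZ]
    exact mulOp_lpoly_mem_Hge n _ (by omega) hx2
  have hsum : ∑ a, ⟪phiDiff h X (v a), phiDiff h Y (v a)⟫_ℂ = ∑ l ∈ Finset.Icc (-(n : ℤ)) n,
      ((-l).toNat : ℂ) * ⟪lieCoeff n X l, lieCoeff n Y l⟫_ℂ := by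
    -- For fixed `k`, different `l` land in different modes, so only diagonal terms survive.
    have hterm : ∀ (k : Fin n) j, ⟪phiDiff h X (v (k, j)), phiDiff h Y (v (k, j))⟫_ℂ =
        ∑ l ∈ Finset.Icc (-(n : ℤ)) n, if l + ((k : ℕ) : ℤ) < 0 then
          ⟪⁅lieCoeff n X l, e j⁆, ⁅lieCoeff n Y l, e j⁆⟫_ℂ else 0 := by
      intro k j
      rw [Submodule.coe_inner, phiDiff_mono h hX (hw k j), phiDiff_mono h hY (hw k j),
        LinearIsometryEquiv.inner_map_map, sum_inner]
      refine Finset.sum_congr rfl fun l hl => ?_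
      split_ifs with hlk
      · rw [inner_sum, Finset.sum_eq_single l]
        · rw [if_pos hlk, inner_mono_mono, if_pos rfl]
        · intro l' _ hl'
          split_ifs
          · rw [inner_mono_mono, if_neg (by omega)]
          · exact inner_zero_right _
        · exact fun h' => absurd hl h'
      · exact inner_zero_left _
    rw [Fintype.sum_prod_type]
    simp only [hterm]
    have h1 : ∀ k : Fin n, ∑ j, (∑ l ∈ Finset.Icc (-(n : ℤ)) n, if l + ((k : ℕ) : ℤ) < 0 then
          ⟪⁅lieCoeff n X l, e j⁆, ⁅lieCoeff n Y l, e j⁆⟫_ℂ else 0) =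
        ∑ l ∈ Finset.Icc (-(n : ℤ)) n, if l + ((k : ℕ) : ℤ) < 0 then
          ⟪lieCoeff n X l, lieCoeff n Y l⟫_ℂ else 0 := by
      intro k
      rw [Finset.sum_comm]
      refine Finset.sum_congr rfl fun l _ => ?_
      split_ifs
      · exact sum_inner_lie e _ _
      · exact Finset.sum_const_zero
    simp only [h1]
    rw [Finset.sum_comm]
    exact Finset.sum_congr rfl fun l hl => sum_range_ite_neg (Finset.mem_Icc.1 hl).1 _
  rw [← hsum]
  exact hasTraceAdjointMul_of_orthonormal hv (hvan X hX) (hvan Y hY)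

theorem inner_lieCoeff_swap {n : ℕ} {X Y : OmegaAlgLie K}
    (hX : IsLaurentPoly n fun θ => KC.ofReal (X.1 θ))
    (hY : IsLaurentPoly n fun θ => KC.ofReal (Y.1 θ)) {k : ℤ}
    (hk : k ∈ Finset.Icc (-(n : ℤ)) n) :
    ⟪lieCoeff n X (-k), lieCoeff n Y (-k)⟫_ℂ = ⟪lieCoeff n Y k, lieCoeff n X k⟫_ℂ := by
  rw [lieCoeff_neg hX hk, lieCoeff_neg hY hk, inner_neg_neg, inner_conjT]

/-- By reality, the substitution `l ↦ -l` turns the weight `l⁻` of the second trace into `l⁺`, and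
`l⁻ - l⁺ = -l`. -/
theorem hasOmegaHS_phiDiff {m : ℕ} {γ : Circ → UN N} (h : γ ∈ OmegaAlgM K m) {n : ℕ}
    {X Y : OmegaAlgLie K} (hX : IsLaurentPoly n fun θ => KC.ofReal (X.1 θ))
    (hY : IsLaurentPoly n fun θ => KC.ofReal (Y.1 θ)) :
    HasOmegaHS (phiDiff h X) (phiDiff h Y) (∑ l ∈ Finset.Icc (-(n : ℤ)) n,
      Complex.I * l * ⟪lieCoeff n X l, lieCoeff n Y l⟫_ℂ) := by
  refine ⟨_, _, hasTraceAdjointMul_phiDiff h hX hY, hasTraceAdjointMul_phiDiff h hY hX, ?_⟩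
  have h1 : ∑ l ∈ Finset.Icc (-(n : ℤ)) n,
      ((-l).toNat : ℂ) * ⟪lieCoeff n Y l, lieCoeff n X l⟫_ℂ =
      ∑ l ∈ Finset.Icc (-(n : ℤ)) n, (l.toNat : ℂ) * ⟪lieCoeff n X l, lieCoeff n Y l⟫_ℂ := by
    refine Finset.sum_nbij' (fun l => -l) (fun l => -l) ?_ ?_ ?_ ?_ ?_
    · intro l hl; rw [Finset.mem_Icc] at *; omega
    · intro l hl; rw [Finset.mem_Icc] at *; omega
    · intro l _; exact neg_neg l
    · intro l _; exact neg_neg l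
    · intro l hl; rw [inner_lieCoeff_swap hX hY hl]
  rw [h1, ← Finset.sum_sub_distrib, Finset.mul_sum]
  refine Finset.sum_congr rfl fun l _ => ?_
  have h2 : ((-l).toNat : ℂ) = (l.toNat : ℂ) - l := by
    have h3 : (((-l).toNat : ℤ) : ℂ) = ((l.toNat : ℤ) : ℂ) - (l : ℂ) := by
      rw [← Int.cast_sub]
      congr 1
      omega
    exact_mod_cast h3
  rw [h2]
  ring

/-- A linear left inverse of `i` shows that `f` itself is differentiable, so `deriv f x` is not a
default value. It transfers the derivative in `𝔨` to `𝔨_ℂ`. -/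
theorem map_deriv_of_injective {E F : Type} [NormedAddCommGroup E] [NormedSpace ℝ E]
    [FiniteDimensional ℝ E] [NormedAddCommGroup F] [NormedSpace ℝ F] [FiniteDimensional ℝ F]
    (i : E →ₗ[ℝ] F) (hi : Function.Injective i) {f : ℝ → E} {f' : F} {x : ℝ}
    (h : HasDerivAt (fun s => i (f s)) f' x) : i (deriv f x) = f' := by
  obtain ⟨r, hr⟩ := LinearMap.exists_leftInverse_of_injective i (LinearMap.ker_eq_bot.2 hi)
  have h2 := (LinearMap.toContinuousLinearMap r).hasFDerivAt.comp_hasDerivAt x h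
  have h3 : (LinearMap.toContinuousLinearMap r ∘ fun s => i (f s)) = f :=
    funext fun s => LinearMap.congr_fun hr (f s)
  rw [h3] at h2
  have h4 := ((LinearMap.toContinuousLinearMap i).hasFDerivAt.comp_hasDerivAt x h2).unique h
  rw [h2.deriv]
  exact h4

theorem ofReal_deriv {n : ℕ} {Y : OmegaAlgLie K}
    (hY : IsLaurentPoly n fun θ => KC.ofReal (Y.1 θ)) (x : ℝ) :
    KC.ofReal (deriv (fun s : ℝ => Y.1 (s : Circ)) x) = ∑ k ∈ Finset.Icc (-(n : ℤ)) n,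
      fourier k (x : Circ) • (Complex.I * k) • lieCoeff n Y k := by
  have h1 : HasDerivAt (fun s : ℝ => KC.ofReal (Y.1 (s : Circ))) (∑ k ∈ Finset.Icc (-(n : ℤ)) n,
      fourier k (x : Circ) • (Complex.I * k) • lieCoeff n Y k) x := by
    rw [funext fun s : ℝ => ofReal_eq_sum hY (s : Circ)]
    refine HasDerivAt.fun_sum fun k _ => ?_
    have h2 := (hasDerivAt_fourier (2 * π) k x).smul_const (lieCoeff n Y k)
    convert h2 using 1
    rw [smul_smul]
    congr 1
    have hπ : (π : ℂ) ≠ 0 := by exact_mod_cast Real.pi_ne_zero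
    push_cast
    field_simp
  -- The derivative in `𝔨` depends only on the topology; any norm inducing it will do.
  let _ : NormedAddCommGroup (Mat N) := Matrix.normedAddCommGroup
  let _ : NormedSpace ℝ (Mat N) := Matrix.normedSpace
  let _ : NormedAddCommGroup (lieAlg K) := Submodule.normedAddCommGroup (lieAlg K).toSubmodule
  let _ : NormedSpace ℝ (lieAlg K) := Submodule.normedSpace (lieAlg K).toSubmodule
  exact map_deriv_of_injective (KC.ofRealLin K) KC.ofReal_injective h1

/-- Parseval for Laurent polynomials: differentiation multiplies `B_l` by `i l`, and only terms of
equal frequency have nonzero mean. -/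
theorem omegaLoop_eq {n : ℕ} {X Y : OmegaAlgLie K}
    (hX : IsLaurentPoly n fun θ => KC.ofReal (X.1 θ))
    (hY : IsLaurentPoly n fun θ => KC.ofReal (Y.1 θ)) :
    (omegaLoop K X Y : ℂ) = ∑ l ∈ Finset.Icc (-(n : ℤ)) n,
      Complex.I * l * ⟪lieCoeff n X l, lieCoeff n Y l⟫_ℂ := by
  let g : Circ → ℂ := fun θ => ∑ k ∈ Finset.Icc (-(n : ℤ)) n, ∑ l ∈ Finset.Icc (-(n : ℤ)) n,
    fourier (l - k) θ * (Complex.I * l * ⟪lieCoeff n X k, lieCoeff n Y l⟫_ℂ)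
  have hg : ∀ x : ℝ, ((-killingForm ℝ (lieAlg K) (X.1 (x : Circ))
      (deriv (fun s : ℝ => Y.1 (s : Circ)) x) : ℝ) : ℂ) = g x := by
    intro x
    rw [← inner_ofReal, ofReal_deriv hY, ofReal_eq_sum hX, sum_inner]
    refine Finset.sum_congr rfl fun k _ => ?_
    rw [inner_sum]
    refine Finset.sum_congr rfl fun l _ => ?_
    rw [inner_smul_left, inner_smul_right, inner_smul_right, ← fourier_neg, sub_eq_neg_add,
      fourier_add]
    ring
  have h1 : (omegaLoop K X Y : ℂ) = ∫ θ, g θ ∂circMeasure := by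
    rw [omegaLoop, Complex.ofReal_mul, ← intervalIntegral.integral_ofReal]
    simp only [hg]
    have h2 := AddCircle.intervalIntegral_preimage (2 * π) 0 g
    rw [zero_add] at h2
    rw [h2, AddCircle.integral_haarAddCircle, Complex.ofReal_inv, Complex.real_smul,
      Complex.ofReal_inv]
  have hint : ∀ (k : ℤ) (z : ℂ), Integrable (fun θ => fourier k θ * z) circMeasure := fun k z =>
    (ContinuousMap.continuous _ |>.mul continuous_const).integrable_of_hasCompactSupport
      (HasCompactSupport.of_compactSpace _)
  rw [h1, integral_finsetSum _ fun k _ => integrable_finsetSum _ fun l _ => hint _ _]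
  refine Finset.sum_congr rfl fun k hk => ?_
  rw [integral_finsetSum _ fun l _ => hint _ _, Finset.sum_eq_single k]
  · rw [integral_mul_const, integral_fourier, if_pos (sub_self k), one_mul]
  · intro l _ hl
    rw [integral_mul_const, integral_fourier, if_neg (sub_ne_zero.2 hl), zero_mul]
  · exact fun h' => absurd hk h'

theorem loopCoeff_eq {n : ℕ} {X : OmegaAlgLie K}
    (hX : IsLaurentPoly n fun θ => KC.ofReal (X.1 θ)) (k : ℤ) :
    loopCoeff K X k = if k ∈ Finset.Icc (-(n : ℤ)) n then lieCoeff n X k else 0 := by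
  have hint : ∀ (k : ℤ) (z : KC K), Integrable (fun θ => fourier k θ • z) circMeasure := fun k z =>
    (trig k z).continuous.integrable_of_hasCompactSupport (HasCompactSupport.of_compactSpace _)
  rw [loopCoeff, fourierCoeff]
  simp only [ofReal_eq_sum hX, Finset.smul_sum, smul_smul, ← fourier_add]
  rw [integral_finsetSum _ fun l _ => hint _ _]
  have h1 : ∀ l, ∫ θ, fourier (-k + l) θ • lieCoeff n X l ∂circMeasure =
      if k = l then lieCoeff n X l else 0 := by
    intro l
    rw [integral_smul_const, integral_fourier]
    by_cases hkl : k = l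
    · rw [if_pos hkl, if_pos (by omega), one_smul]
    · rw [if_neg hkl, if_neg (by omega), zero_smul]
  simp only [h1, Finset.sum_ite_eq]

theorem hasSum_traceAd {n : ℕ} {X Y : OmegaAlgLie K}
    (hX : IsLaurentPoly n fun θ => KC.ofReal (X.1 θ))
    (hY : IsLaurentPoly n fun θ => KC.ofReal (Y.1 θ)) :
    HasSum (fun k : ℤ => Complex.I * k * traceAd K (loopCoeff K X k) (loopCoeff K Y k))
      (∑ l ∈ Finset.Icc (-(n : ℤ)) n,
        Complex.I * l * ⟪lieCoeff n X l, lieCoeff n Y l⟫_ℂ) := by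
  have h1 : ∑ l ∈ Finset.Icc (-(n : ℤ)) n,
        Complex.I * l * ⟪lieCoeff n X l, lieCoeff n Y l⟫_ℂ =
      ∑ l ∈ Finset.Icc (-(n : ℤ)) n,
        Complex.I * l * traceAd K (loopCoeff K X l) (loopCoeff K Y l) := by
    refine Finset.sum_congr rfl fun l hl => ?_
    rw [traceAd_eq_inner, loopCoeff_eq hX, loopCoeff_eq hY, if_pos hl, if_pos hl]
  rw [h1]
  refine hasSum_sum_of_ne_finset_zero fun l hl => ?_
  rw [traceAd_eq_inner, loopCoeff_eq hX, if_neg hl, inner_zero_left, mul_zero]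

end Forms

end LoopGr

end

theorem lemmaA1 {N : ℕ} (K : Subgroup (LoopGr.UN N)) (hK : IsClosed (K : Set (LoopGr.UN N)))
    [LieAlgebra.IsKilling ℝ (LoopGr.lieAlg K)] :
    (∀ γ ∈ LoopGr.OmegaAlg K, LoopGr.phi K γ ∈ LoopGr.GrZero (LoopGr.KC K)) ∧
    Set.InjOn (LoopGr.phi K) (LoopGr.OmegaAlg K) ∧
    ∀ γ ∈ LoopGr.OmegaAlg K,
      ∃ D : LoopGr.OmegaAlgLie K →ₗ[ℝ] (LoopGr.phi K γ →L[ℂ] (LoopGr.phi K γ)ᗮ),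
        LoopGr.IsDifferentialPhi K γ D ∧
        Function.Injective D ∧
        (∀ X, LoopGr.IsHilbertSchmidt (D X)) ∧
        (∀ X Y, LoopGr.HasOmegaHS (D X) (D Y) (LoopGr.omegaLoop K X Y)) ∧
        ∀ X Y, HasSum
          (fun k : ℤ => Complex.I * k *
            LoopGr.traceAd K (LoopGr.loopCoeff K X k) (LoopGr.loopCoeff K Y k))
          (LoopGr.omegaLoop K X Y : ℂ) := by
  refine ⟨fun γ hγ => LoopGr.phi_mem_GrZero hγ, LoopGr.injOn_phi, fun γ hγ => ?_⟩
  obtain ⟨m, h⟩ := Set.mem_iUnion.1 hγ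
  have hdeg : ∀ X Y : LoopGr.OmegaAlgLie K, ∃ n,
      LoopGr.IsLaurentPoly n (fun θ => LoopGr.KC.ofReal (X.1 θ)) ∧
      LoopGr.IsLaurentPoly n (fun θ => LoopGr.KC.ofReal (Y.1 θ)) := by
    intro X Y
    obtain ⟨a, ha⟩ := LoopGr.exists_isLaurentPoly_ofReal X
    obtain ⟨b, hb⟩ := LoopGr.exists_isLaurentPoly_ofReal Y
    exact ⟨max a b, ha.mono (le_max_left _ _), hb.mono (le_max_right _ _)⟩
  refine ⟨LoopGr.phiDiff h, fun X => ⟨fun c hc => LoopGr.hasGrVelocity_phi h X hc,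
    LoopGr.phiDiff_formula h X⟩, LoopGr.phiDiff_injective h,
    LoopGr.isHilbertSchmidt_phiDiff h, fun X Y => ?_, fun X Y => ?_⟩
  · obtain ⟨n, hX, hY⟩ := hdeg X Y
    rw [LoopGr.omegaLoop_eq hX hY]
    exact LoopGr.hasOmegaHS_phiDiff h hX hY
  · obtain ⟨n, hX, hY⟩ := hdeg X Y
    rw [LoopGr.omegaLoop_eq hX hY]
    exact LoopGr.hasSum_traceAd hX hY
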